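/- Let $d\ge 1$ and let $\Omega\subseteq\mathbb{R}^d$ be a bounded domain (a non-empty, bounded, open, connected set). For $u\in L^1(\Omega)$ let $|Du|(\Omega)=\sup\{\int_\Omega u\,\mathrm{div}\,\varphi\,dx:\ \varphi\in C_c^1(\Omega;\mathbb{R}^d),\ |\varphi|\le 1\}\in[0,\infty]$ and let $BV(\Omega)=\{u\in L^1(\Omega):|Du|(\Omega)<\infty\}$. For $\lambda_1,\lambda_2\ge 0$ and $f,u\in L^1(\Omega)$ put $$\Phi^{\lambda_1,\lambda_2}(u,f)=\inf_{v\in L^1(\Omega)}\ \lambda_1\|v\|_{L^1(\Omega)}+\frac{\lambda_2}{2}\|f-u-v\|_{L^2(\Omega)}^2 ,$$ where $\|w\|_{L^2(\Omega)}=\infty$ for $w\notin L^2(\Omega)$ and $0\cdot\infty=0$, and let $$S_f(\lambda_1,\lambda_2)=\operatorname*{argmin}_{u\in BV(\Omega)}\ |Du|(\Omega)+\Phi^{\lambda_1,\lambda_2}(u,f).$$ Then there exist data $f\in L^2(\Omega)$ and training data $\tilde u\in L^2(\Omega)$ such that the unconstrained non-smooth bilevel problem $$\min_{\lambda_1,\lambda_2\ge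 0}\ \|u_{\lambda_1,\lambda_2}-\tilde u\|_{L^2(\Omega)}^2\qquad\text{subject to}\qquad u_{\lambda_1,\lambda_2}\in S_f(\lambda_1,\lambda_2)$$ has no solution, that is, no triple $(\lambda_1,\lambda_2,u)$ with $\lambda_1,\lambda_2\ge0$ and $u\in S_f(\lambda_1,\lambda_2)$ minimises $\|u-\tilde u\|_{L^2(\Omega)}^2$ among all such triples. More precisely, $f$ and $\tilde u$ can be chosen such that the infimum of $\|u-\tilde u\|_{L^2(\Omega)}^2$ over all such triples is $0$; such that $\|u-\tilde u\|_{L^2(\Omega)}^2>0$ for every such triple; and such that there is $\lambda^*\ge 0$ with the property that for every fixed $\lambda_1\ge\lambda^*$ the set $S_f(\lambda_1,\lambda_2)$ is non-empty for all sufficiently large $\lambda_2$ and $\sup_{u\in S_f(\lambda_1,\lambda_2)}\|u-\tilde u\|_{L^2(\Omega)}^2\to 0$ as $\lambda_2\to\infty$. -/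

import Mathlib

open MeasureTheory Filter Topology
open scoped NNReal ENNReal

namespace TVIC

/-- The divergence of a vector field on `ℝᵈ`. -/
noncomputable def divergence {d : ℕ}
    (φ : EuclideanSpace ℝ (Fin d) → EuclideanSpace ℝ (Fin d))
    (x : EuclideanSpace ℝ (Fin d)) : ℝ :=
  ∑ i, (fderiv ℝ φ x (EuclideanSpace.single i 1)) i

/-- Test fields for the total variation: `C¹` vector fields with compact support in `Ω` and
pointwise Euclidean norm at most `1`. -/
def testFields {d : ℕ} (Ω : Set (EuclideanSpace ℝ (Fin d))) :
    Set (EuclideanSpace ℝ (Fin d) → EuclideanSpace ℝ (Fin d)) :=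
  {φ | ContDiff ℝ 1 φ ∧ HasCompactSupport φ ∧ tsupport φ ⊆ Ω ∧ ∀ x, ‖φ x‖ ≤ 1}

/-- The total variation `|Du|(Ω) ∈ [0, ∞]` of `u ∈ L¹(Ω)`, i.e. the supremum of `∫_Ω u div φ`
over all test fields (`φ = 0` is a test field, so cutting off negative values is harmless). -/
noncomputable def totalVariation {d : ℕ} (Ω : Set (EuclideanSpace ℝ (Fin d)))
    (u : EuclideanSpace ℝ (Fin d) → ℝ) : ℝ≥0∞ :=
  ⨆ φ ∈ testFields Ω, ENNReal.ofReal (∫ x in Ω, u x * divergence φ x)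

/-- `BV(Ω)`: functions in `L¹(Ω)` with finite total variation. -/
def BV {d : ℕ} (Ω : Set (EuclideanSpace ℝ (Fin d))) : Set (EuclideanSpace ℝ (Fin d) → ℝ) :=
  {u | MemLp u 1 (volume.restrict Ω) ∧ totalVariation Ω u < ∞}

/-- The infimal convolution fidelity
`Φ(u, f) = inf_{v ∈ L¹(Ω)} l₁ ‖v‖_{L¹(Ω)} + (l₂ / 2) ‖f - u - v‖²_{L²(Ω)}`, where the `L²` norm is
`∞` outside `L²(Ω)` and `0 · ∞ = 0`. -/
noncomputable def icFidelity {d : ℕ} (Ω : Set (EuclideanSpace ℝ (Fin d))) (l₁ l₂ : ℝ≥0)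
    (u f : EuclideanSpace ℝ (Fin d) → ℝ) : ℝ≥0∞ :=
  ⨅ (v : EuclideanSpace ℝ (Fin d) → ℝ) (_ : MemLp v 1 (volume.restrict Ω)),
    (l₁ : ℝ≥0∞) * eLpNorm v 1 (volume.restrict Ω) +
      (l₂ : ℝ≥0∞) / 2 * eLpNorm (f - u - v) 2 (volume.restrict Ω) ^ 2

/-- The energy `|Du|(Ω) + Φ(u, f)` of the lower level problem. -/
noncomputable def energy {d : ℕ} (Ω : Set (EuclideanSpace ℝ (Fin d)))
    (f : EuclideanSpace ℝ (Fin d) → ℝ) (l₁ l₂ : ℝ≥0) (u : EuclideanSpace ℝ (Fin d) → ℝ) : ℝ≥0∞ :=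
  totalVariation Ω u + icFidelity Ω l₁ l₂ u f

/-- The set of minimisers over `BV(Ω)` of the lower level problem. -/
def lowerArgmin {d : ℕ} (Ω : Set (EuclideanSpace ℝ (Fin d)))
    (f : EuclideanSpace ℝ (Fin d) → ℝ) (l₁ l₂ : ℝ≥0) : Set (EuclideanSpace ℝ (Fin d) → ℝ) :=
  {u | u ∈ BV Ω ∧ ∀ w ∈ BV Ω, energy Ω f l₁ l₂ u ≤ energy Ω f l₁ l₂ w}

/-- The cost `‖u - ũ‖²_{L²(Ω)} ∈ [0, ∞]`; it is `∞` when `u - ũ` is not square integrable. -/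
noncomputable def costL2 {d : ℕ} (Ω : Set (EuclideanSpace ℝ (Fin d)))
    (utilde u : EuclideanSpace ℝ (Fin d) → ℝ) : ℝ≥0∞ :=
  eLpNorm (u - utilde) 2 (volume.restrict Ω) ^ 2

/-- The values of the cost at the feasible points `(l₁, l₂, u)`, `l₁, l₂ ≥ 0`,
`u` a lower level minimiser for `(l₁, l₂)`. -/
def bilevelValues {d : ℕ} (Ω : Set (EuclideanSpace ℝ (Fin d)))
    (f utilde : EuclideanSpace ℝ (Fin d) → ℝ) : Set ℝ≥0∞ :=
  {c | ∃ (l₁ l₂ : ℝ≥0) (u : EuclideanSpace ℝ (Fin d) → ℝ),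
    u ∈ lowerArgmin Ω f l₁ l₂ ∧ c = costL2 Ω utilde u}

/-- `(l₁, l₂, u)` solves the bilevel problem: it is feasible and its cost is minimal among all
feasible points. -/
def IsBilevelSolution {d : ℕ} (Ω : Set (EuclideanSpace ℝ (Fin d)))
    (f utilde : EuclideanSpace ℝ (Fin d) → ℝ) (l₁ l₂ : ℝ≥0)
    (u : EuclideanSpace ℝ (Fin d) → ℝ) : Prop :=
  u ∈ lowerArgmin Ω f l₁ l₂ ∧
    ∀ (m₁ m₂ : ℝ≥0) (w : EuclideanSpace ℝ (Fin d) → ℝ), w ∈ lowerArgmin Ω f m₁ m₂ →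
      costL2 Ω utilde u ≤ costL2 Ω utilde w

end TVIC

/-!
Both the data and the training data are the same function `f`: a smooth radial plateau supported in
a ball inside `Ω`, which has values in `[0, 1]` and positive, finite total variation.

*The value zero is not attained.* If `u = f` were a minimiser, compare it with `(1 - ε) f`: the
total variation drops by `ε |Df|(Ω)`, while the fidelity, bounded by its value at `v = 0`, grows
only by `O(ε²)` (`costL2_pos`). This works for all `l₁, l₂ ≥ 0`, because the fidelity is bounded by
a quadratic near `u = f`.

*The value zero is approached.* For `l₂ > 0` the fidelity is the integral of the Huber function of
`f - u` (`icFidelity_eq_ofReal_integral_huber`), which differs from `l₁ |f - u|` by at most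
`l₁² / (2 l₂)`. The field `φ` of `exists_calibrated`, equal to the unit radial field where `f`
decreases, attains the supremum in `|Df|(Ω)`; hence `|Du|(Ω) ≥ |Df|(Ω) - M ‖u - f‖₁` with
`M = sup |div φ|`, and comparing the energies of `u` and `f` gives
`(l₁ - M) ‖u - f‖₁ ≤ l₁² |Ω| / (2 l₂)` (`integral_abs_sub_le_of_mem_lowerArgmin`). To pass from `L¹`
to `L²`, minimisers are bounded uniformly: for a smooth bounded nonexpansive `T` fixing `[0, 1]`
one has `|D(T ∘ u)|(Ω) ≤ |Du|(Ω)` (`totalVariation_comp_le`) and `|f - T ∘ u| ≤ |f - u|`, so that a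
minimiser satisfies `|f - u| ≤ |f - T ∘ u|` almost everywhere, the Huber function being strictly
increasing in the modulus (`exists_abs_sub_le_of_mem_lowerArgmin`).

*Minimisers exist* (`lowerArgmin_nonempty`). The same truncation restricts the competitors to a ball
of `L²(Ω)`, where the energy is convex and lower semicontinuous. No compactness in `BV` is needed:
`exists_forall_le_of_convex_sublevel` produces the minimiser in the Hilbert space `L²(Ω)` directly.
-/

namespace TVIC

/-! ### Convex minimisation in a Hilbert space -/

/-- A function on a Hilbert space whose sublevel sets are closed and convex attains its minimum
over every nonempty, bounded, closed, convex set: the points of minimal norm of the nested sets of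
almost-minimisers form a Cauchy sequence, by the parallelogram identity. -/
theorem exists_forall_le_of_convex_sublevel {H : Type*} [NormedAddCommGroup H]
    [InnerProductSpace ℝ H] [CompleteSpace H] {K : Set H} (hne : K.Nonempty)
    (hbdd : Bornology.IsBounded K) (hclosed : IsClosed K) (hconv : Convex ℝ K) {E : H → ℝ≥0∞}
    (hEclosed : ∀ c, IsClosed {x | E x ≤ c}) (hEconv : ∀ c, Convex ℝ {x | E x ≤ c}) :
    ∃ x ∈ K, ∀ y ∈ K, E x ≤ E y := by
  set m : ℝ≥0∞ := ⨅ x ∈ K, E x with hm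
  have hmle : ∀ y ∈ K, m ≤ E y := fun y hy => iInf₂_le y hy
  by_cases hmtop : m = ∞
  · obtain ⟨x, hx⟩ := hne
    refine ⟨x, hx, fun y hy => ?_⟩
    have := hmle y hy
    rw [hmtop, top_le_iff] at this
    rw [this]
    exact le_top
  set A : ℕ → Set H := fun n => K ∩ {x | E x ≤ m + ((n : ℝ≥0∞) + 1)⁻¹} with hA
  have hAclosed : ∀ n, IsClosed (A n) := fun n => hclosed.inter (hEclosed _)
  have hAconv : ∀ n, Convex ℝ (A n) := fun n => hconv.inter (hEconv _)
  have hAne : ∀ n, (A n).Nonempty := by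
    intro n
    have hlt : m < m + ((n : ℝ≥0∞) + 1)⁻¹ := by
      refine ENNReal.lt_add_right hmtop ?_
      simp [ENNReal.inv_eq_zero]
    obtain ⟨x, hx⟩ := iInf_lt_iff.1 hlt
    obtain ⟨hxK, hx⟩ := iInf_lt_iff.1 hx
    exact ⟨x, hxK, hx.le⟩
  have hAanti : ∀ {n k : ℕ}, n ≤ k → A k ⊆ A n := by
    intro n k hnk x hx
    refine ⟨hx.1, le_trans (b := m + ((k : ℝ≥0∞) + 1)⁻¹) hx.2 ?_⟩
    gcongr
  have hmin : ∀ n, ∃ x ∈ A n, ∀ y ∈ A n, ‖x‖ ≤ ‖y‖ := by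
    intro n
    obtain ⟨x, hx, h⟩ :=
      exists_norm_eq_iInf_of_complete_convex (hAne n) (hAclosed n).isComplete (hAconv n) 0
    refine ⟨x, hx, fun y hy => ?_⟩
    rw [zero_sub, norm_neg] at h
    rw [h]
    have : (⨅ w : A n, ‖(0 : H) - w‖) ≤ ‖(0 : H) - (⟨y, hy⟩ : A n)‖ :=
      ciInf_le ⟨0, by rintro _ ⟨w, rfl⟩; exact norm_nonneg _⟩ _
    simpa using this
  choose x hxA hxmin using hmin
  obtain ⟨R, hR⟩ := hbdd.exists_norm_le
  have hmono : Monotone fun n => ‖x n‖ ^ 2 := by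
    intro n k hnk
    have := hxmin n (x k) (hAanti hnk (hxA k))
    dsimp only
    gcongr
  have hbd : BddAbove (Set.range fun n => ‖x n‖ ^ 2) := by
    refine ⟨R ^ 2, ?_⟩
    rintro _ ⟨n, rfl⟩
    have := hR (x n) (hxA n).1
    dsimp only
    gcongr
  set L := ⨆ n, ‖x n‖ ^ 2 with hL
  have htend : Tendsto (fun n => ‖x n‖ ^ 2) atTop (𝓝 L) := tendsto_atTop_ciSup hmono hbd
  have hleL : ∀ n, ‖x n‖ ^ 2 ≤ L := fun n => le_ciSup hbd n
  have hcauchy : CauchySeq x := by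
    refine cauchySeq_of_le_tendsto_0 (fun N => √(4 * (L - ‖x N‖ ^ 2))) ?_ ?_
    · intro n k N hn hk
      rw [dist_eq_norm]
      refine Real.le_sqrt_of_sq_le ?_
      have hmid : (1 / 2 : ℝ) • x n + (1 / 2 : ℝ) • x k ∈ A N :=
        hAconv N (hAanti hn (hxA n)) (hAanti hk (hxA k)) (by norm_num) (by norm_num) (by norm_num)
      have h1 := hxmin N _ hmid
      rw [← smul_add, norm_smul] at h1
      have h2 : ‖x N‖ * 2 ≤ ‖x n + x k‖ := by
        norm_num at h1
        linarith
      have h3 := parallelogram_law_with_norm ℝ (x n) (x k)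
      have h4 := hleL n
      have h5 := hleL k
      nlinarith [norm_nonneg (x N), norm_nonneg (x n + x k)]
    · have : Tendsto (fun N => √(4 * (L - ‖x N‖ ^ 2))) atTop (𝓝 √(4 * (L - L))) :=
        ((tendsto_const_nhds.sub htend).const_mul 4).sqrt
      simpa using this
  obtain ⟨z, hz⟩ := cauchySeq_tendsto_of_complete hcauchy
  have hzA : ∀ n, z ∈ A n := fun n =>
    (hAclosed n).mem_of_tendsto hz (eventually_atTop.2 ⟨n, fun k hk => hAanti hk (hxA k)⟩)
  refine ⟨z, (hzA 0).1, fun y hy => le_trans ?_ (hmle y hy)⟩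
  have hlim : Tendsto (fun n : ℕ => m + ((n : ℝ≥0∞) + 1)⁻¹) atTop (𝓝 (m + 0)) := by
    refine tendsto_const_nhds.add ?_
    have := ENNReal.tendsto_inv_nat_nhds_zero.comp (tendsto_add_atTop_nat 1)
    simpa [Function.comp_def] using this
  rw [add_zero] at hlim
  exact ge_of_tendsto' hlim fun n => (hzA n).2

/-! ### The Huber function -/

/-- The integrand `l₁ |v| + (l₂ / 2) (t - v)²` of the infimal convolution. -/
noncomputable def splitCost (l₁ l₂ t v : ℝ) : ℝ := l₁ * |v| + l₂ / 2 * (t - v) ^ 2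

/-- Soft thresholding at level `l₁ / l₂`, the minimiser of `splitCost l₁ l₂ t`. -/
noncomputable def softThreshold (l₁ l₂ t : ℝ) : ℝ := t - max (-(l₁ / l₂)) (min t (l₁ / l₂))

/-- The Huber function, the minimum over `v` of `l₁ |v| + (l₂ / 2) (t - v)²`. -/
noncomputable def huber (l₁ l₂ t : ℝ) : ℝ := splitCost l₁ l₂ t (softThreshold l₁ l₂ t)

section Huber

variable {l₁ l₂ : ℝ}

theorem continuous_softThreshold : Continuous (softThreshold l₁ l₂) := by
  unfold softThreshold; fun_prop

theorem continuous_huber : Continuous (huber l₁ l₂) := by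
  unfold huber splitCost softThreshold; fun_prop

theorem abs_softThreshold_le (h₁ : 0 ≤ l₁) (h₂ : 0 < l₂) (t : ℝ) :
    |softThreshold l₁ l₂ t| ≤ |t| := by
  have hk : 0 ≤ l₁ / l₂ := by positivity
  unfold softThreshold
  rcases max_cases (-(l₁ / l₂)) (min t (l₁ / l₂)) with h | h <;>
  rcases min_cases t (l₁ / l₂) with h' | h' <;>
  rcases abs_cases t with h3 | h3 <;> rw [abs_le] <;> constructor <;> linarith

theorem huber_le_splitCost (h₁ : 0 ≤ l₁) (h₂ : 0 < l₂) (t v : ℝ) :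
    huber l₁ l₂ t ≤ splitCost l₁ l₂ t v := by
  obtain ⟨k, rfl⟩ : ∃ k, l₁ = l₂ * k := ⟨l₁ / l₂, by field_simp⟩
  have hk : 0 ≤ k := nonneg_of_mul_nonneg_right h₁ h₂
  unfold huber splitCost softThreshold
  rw [mul_div_cancel_left₀ _ h₂.ne']
  suffices k * |t - max (-k) (min t k)| + (t - (t - max (-k) (min t k))) ^ 2 / 2 ≤
      k * |v| + (t - v) ^ 2 / 2 by nlinarith
  have hv1 : k * v ≤ k * |v| := by gcongr; exact le_abs_self v
  have hv2 : k * (-v) ≤ k * |v| := by gcongr; exact neg_le_abs v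
  rcases le_total t k with htk | htk
  · rw [min_eq_left htk]
    rcases le_total (-k) t with h | h
    · rw [max_eq_right h]
      simp only [sub_self, abs_zero, mul_zero, sub_zero, zero_add]
      have h5 : t * v ≤ k * |v| := by
        calc t * v ≤ |t * v| := le_abs_self _
          _ = |t| * |v| := abs_mul _ _
          _ ≤ k * |v| := by gcongr; exact abs_le.2 ⟨h, htk⟩
      nlinarith [sq_nonneg v]
    · rw [max_eq_left h, abs_of_nonpos (by linarith)]
      nlinarith [sq_nonneg (t - v + k)]
  · rw [min_eq_right htk, max_eq_right (by linarith), abs_of_nonneg (by linarith)]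
    nlinarith [sq_nonneg (t - v - k)]

theorem splitCost_nonneg (h₁ : 0 ≤ l₁) (h₂ : 0 < l₂) (t v : ℝ) : 0 ≤ splitCost l₁ l₂ t v := by
  unfold splitCost; positivity

theorem huber_nonneg (h₁ : 0 ≤ l₁) (h₂ : 0 < l₂) (t : ℝ) : 0 ≤ huber l₁ l₂ t :=
  splitCost_nonneg h₁ h₂ _ _

theorem huber_le_mul_abs (h₁ : 0 ≤ l₁) (h₂ : 0 < l₂) (t : ℝ) : huber l₁ l₂ t ≤ l₁ * |t| := by
  simpa [splitCost] using huber_le_splitCost h₁ h₂ t t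

theorem huber_zero (h₁ : 0 ≤ l₁) (h₂ : 0 < l₂) : huber l₁ l₂ 0 = 0 :=
  le_antisymm (by simpa using huber_le_mul_abs h₁ h₂ 0) (huber_nonneg h₁ h₂ 0)

theorem huber_pos (h₁ : 0 < l₁) (h₂ : 0 < l₂) {t : ℝ} (ht : t ≠ 0) : 0 < huber l₁ l₂ t := by
  refine lt_of_le_of_ne (huber_nonneg h₁.le h₂ t) fun h => ht ?_
  unfold huber splitCost at h
  have ha : 0 ≤ l₁ * |softThreshold l₁ l₂ t| := by positivity
  have hb : 0 ≤ l₂ / 2 * (t - softThreshold l₁ l₂ t) ^ 2 := by positivity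
  have ha0 : softThreshold l₁ l₂ t = 0 := by
    have : l₁ * |softThreshold l₁ l₂ t| = 0 := by linarith
    simpa [h₁.ne'] using this
  have hb0 : l₂ / 2 * (t - softThreshold l₁ l₂ t) ^ 2 = 0 := by linarith
  rw [ha0] at hb0
  simpa [h₂.ne'] using hb0

theorem huber_neg (h₁ : 0 ≤ l₁) (h₂ : 0 < l₂) (t : ℝ) : huber l₁ l₂ (-t) = huber l₁ l₂ t := by
  have key : ∀ s, huber l₁ l₂ (-s) ≤ huber l₁ l₂ s := by
    intro s
    refine (huber_le_splitCost h₁ h₂ (-s) (-softThreshold l₁ l₂ s)).trans_eq ?_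
    unfold huber splitCost
    rw [abs_neg]
    ring
  exact le_antisymm (key t) (by simpa using key (-t))

theorem huber_abs (h₁ : 0 ≤ l₁) (h₂ : 0 < l₂) (t : ℝ) : huber l₁ l₂ |t| = huber l₁ l₂ t := by
  rcases abs_choice t with h | h <;> rw [h]
  exact huber_neg h₁ h₂ t

theorem convexOn_huber (h₁ : 0 ≤ l₁) (h₂ : 0 < l₂) : ConvexOn ℝ Set.univ (huber l₁ l₂) := by
  refine ⟨convex_univ, fun s _ t _ a b ha hb hab => ?_⟩
  refine (huber_le_splitCost h₁ h₂ _
    (a * softThreshold l₁ l₂ s + b * softThreshold l₁ l₂ t)).trans ?_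
  simp only [huber, splitCost, smul_eq_mul]
  generalize softThreshold l₁ l₂ s = p
  generalize softThreshold l₁ l₂ t = q
  have e1 : |a * p + b * q| ≤ a * |p| + b * |q| := by
    refine (abs_add_le _ _).trans_eq ?_
    rw [abs_mul, abs_mul, abs_of_nonneg ha, abs_of_nonneg hb]
  have e2 : (a * s + b * t - (a * p + b * q)) ^ 2 ≤ a * (s - p) ^ 2 + b * (t - q) ^ 2 := by
    obtain rfl : b = 1 - a := by linarith
    nlinarith [mul_nonneg (mul_nonneg ha hb) (sq_nonneg ((s - p) - (t - q)))]
  have e3 := mul_le_mul_of_nonneg_left e1 h₁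
  have e4 := mul_le_mul_of_nonneg_left e2 (by positivity : 0 ≤ l₂ / 2)
  linarith

theorem huber_lt_of_abs_lt (h₁ : 0 < l₁) (h₂ : 0 < l₂) {s t : ℝ} (h : |s| < |t|) :
    huber l₁ l₂ s < huber l₁ l₂ t := by
  have ht : 0 < |t| := (abs_nonneg s).trans_lt h
  have ha : 0 ≤ |s| / |t| := by positivity
  have hb : 0 ≤ 1 - |s| / |t| := sub_nonneg.2 ((div_le_one ht).2 h.le)
  have hc := (convexOn_huber h₁.le h₂).2 (Set.mem_univ |t|) (Set.mem_univ (0 : ℝ)) ha hb (by ring)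
  simp only [smul_eq_mul, mul_zero, add_zero, huber_zero h₁.le h₂,
    div_mul_cancel₀ _ ht.ne', huber_abs h₁.le h₂] at hc
  refine hc.trans_lt ?_
  have hp := huber_pos h₁ h₂ (abs_pos.1 ht)
  calc |s| / |t| * huber l₁ l₂ t < 1 * huber l₁ l₂ t := by
        gcongr
        exact (div_lt_one ht).2 h
    _ = _ := one_mul _

theorem huber_le_of_abs_le (h₁ : 0 < l₁) (h₂ : 0 < l₂) {s t : ℝ} (h : |s| ≤ |t|) :
    huber l₁ l₂ s ≤ huber l₁ l₂ t := by
  rcases h.lt_or_eq with h | h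
  · exact (huber_lt_of_abs_lt h₁ h₂ h).le
  · rw [← huber_abs h₁.le h₂ s, h, huber_abs h₁.le h₂]

theorem abs_huber_sub_le (h₁ : 0 ≤ l₁) (h₂ : 0 < l₂) (s t : ℝ) :
    |huber l₁ l₂ s - huber l₁ l₂ t| ≤ l₁ * |s - t| := by
  have key : ∀ s t, huber l₁ l₂ s ≤ huber l₁ l₂ t + l₁ * |s - t| := by
    intro s t
    refine (huber_le_splitCost h₁ h₂ s (softThreshold l₁ l₂ t + (s - t))).trans ?_
    unfold huber splitCost
    have := mul_le_mul_of_nonneg_left (abs_add_le (softThreshold l₁ l₂ t) (s - t)) h₁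
    have e : s - (softThreshold l₁ l₂ t + (s - t)) = t - softThreshold l₁ l₂ t := by ring
    rw [e]
    linarith
  have h3 := key s t
  have h4 := key t s
  rw [abs_sub_comm t s] at h4
  rw [abs_le]
  constructor <;> linarith

/-- The Huber function differs from `l₁ |·|` by at most `l₁² / (2 l₂)`, which vanishes as
`l₂ → ∞`. -/
theorem mul_abs_sub_le_huber (h₁ : 0 ≤ l₁) (h₂ : 0 < l₂) (t : ℝ) :
    l₁ * |t| - l₁ ^ 2 / (2 * l₂) ≤ huber l₁ l₂ t := by
  unfold huber splitCost
  generalize softThreshold l₁ l₂ t = v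
  have h3 : |t| ≤ |v| + |t - v| := by
    have := abs_add_le v (t - v)
    simpa using this
  have h4 : l₁ * |t| ≤ l₁ * |v| + l₁ * |t - v| := by nlinarith
  have h5 : l₁ * |t - v| ≤ l₂ / 2 * (t - v) ^ 2 + l₁ ^ 2 / (2 * l₂) := by
    rw [← sub_nonneg]
    have : l₂ / 2 * (t - v) ^ 2 + l₁ ^ 2 / (2 * l₂) - l₁ * |t - v| =
        l₂ / 2 * (|t - v| - l₁ / l₂) ^ 2 := by
      rw [← sq_abs (t - v)]
      field_simp
      ring
    rw [this]
    positivity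
  linarith

end Huber

/-! ### Divergence and integration by parts -/

section Divergence

variable {d : ℕ} {φ : EuclideanSpace ℝ (Fin d) → EuclideanSpace ℝ (Fin d)}

theorem continuous_divergence (hφ : ContDiff ℝ 1 φ) : Continuous (divergence φ) := by
  have := hφ.continuous_fderiv one_ne_zero
  unfold divergence
  fun_prop

theorem divergence_of_notMem_tsupport {x : EuclideanSpace ℝ (Fin d)} (hx : x ∉ tsupport φ) :
    divergence φ x = 0 := by
  simp [divergence, fderiv_of_notMem_tsupport (𝕜 := ℝ) hx]

theorem hasCompactSupport_divergence (hφ : HasCompactSupport φ) :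
    HasCompactSupport (divergence φ) :=
  HasCompactSupport.intro hφ fun _ hx => divergence_of_notMem_tsupport hx

theorem divergence_comp_add_right (z x : EuclideanSpace ℝ (Fin d)) :
    divergence (fun y => φ (y + z)) x = divergence φ (x + z) := by
  simp [divergence, fderiv_comp_add_right]

theorem exists_abs_divergence_le (hφ : ContDiff ℝ 1 φ) (hc : HasCompactSupport φ) :
    ∃ M, 0 ≤ M ∧ ∀ x, |divergence φ x| ≤ M := by
  obtain ⟨M, hM⟩ :=
    (continuous_divergence hφ).bounded_above_of_compact_support (hasCompactSupport_divergence hc)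
  exact ⟨M, (norm_nonneg _).trans (hM 0), hM⟩

/-- Integration by parts against a compactly supported vector field. -/
theorem integral_mul_divergence {f : EuclideanSpace ℝ (Fin d) → ℝ} (hf : ContDiff ℝ 1 f)
    (hφ : ContDiff ℝ 1 φ) (hc : HasCompactSupport φ) :
    ∫ x, f x * divergence φ x = -∫ x, fderiv ℝ f x (φ x) := by
  have hφi : ∀ i, ContDiff ℝ 1 fun x => φ x i := fun i => by fun_prop
  have hci : ∀ i, HasCompactSupport fun x => φ x i := fun i =>
    hc.comp_left (g := fun v : EuclideanSpace ℝ (Fin d) => v i) rfl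
  have hcomp : ∀ i x, (fderiv ℝ φ x (EuclideanSpace.single i 1)) i =
      fderiv ℝ (fun y => φ y i) x (EuclideanSpace.single i 1) := by
    intro i x
    have h1 : HasFDerivAt φ (fderiv ℝ φ x) x := (hφ.differentiable one_ne_zero x).hasFDerivAt
    have h2 := (EuclideanSpace.proj (𝕜 := ℝ) i).hasFDerivAt.comp x h1
    have h3 : (fun y => φ y i) = (EuclideanSpace.proj (𝕜 := ℝ) i) ∘ φ := rfl
    rw [h3, h2.fderiv]
    rfl
  have hexp : ∀ x, fderiv ℝ f x (φ x) =
      ∑ i, fderiv ℝ f x (EuclideanSpace.single i 1) * φ x i := by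
    intro x
    conv_lhs => rw [← (EuclideanSpace.basisFun (Fin d) ℝ).sum_repr (φ x)]
    simp [map_sum, mul_comm]
  have hdf : Continuous (fderiv ℝ f) := hf.continuous_fderiv one_ne_zero
  have hdφ : ∀ i, Continuous (fderiv ℝ fun y => φ y i) := fun i =>
    (hφi i).continuous_fderiv one_ne_zero
  have hi1 : ∀ i, Integrable fun x => fderiv ℝ f x (EuclideanSpace.single i 1) * φ x i := by
    intro i
    refine Continuous.integrable_of_hasCompactSupport ?_ ((hci i).mul_left)
    have := (hφi i).continuous
    fun_prop
  have hi2 : ∀ i, Integrable fun x =>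
      f x * fderiv ℝ (fun y => φ y i) x (EuclideanSpace.single i 1) := by
    intro i
    have := hdφ i
    have := hf.continuous
    exact Continuous.integrable_of_hasCompactSupport (by fun_prop)
      (((hci i).fderiv_apply ℝ (EuclideanSpace.single i 1)).mul_left)
  have hi3 : ∀ i, Integrable fun x => f x * φ x i := by
    intro i
    have := (hφi i).continuous
    have := hf.continuous
    exact Continuous.integrable_of_hasCompactSupport (by fun_prop) ((hci i).mul_left)
  simp only [divergence, hcomp, hexp, Finset.mul_sum]
  rw [integral_finsetSum _ fun i _ => hi2 i, integral_finsetSum _ fun i _ => hi1 i,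
    ← Finset.sum_neg_distrib]
  exact Finset.sum_congr rfl fun i _ => integral_mul_fderiv_eq_neg_fderiv_mul_of_integrable
    (hi1 i) (hi2 i) (hi3 i) (fun x _ => hf.differentiable one_ne_zero x)
    (fun x _ => (hφi i).differentiable one_ne_zero x)

end Divergence

/-! ### The total variation -/

section TotalVariation

variable {d : ℕ} {Ω : Set (EuclideanSpace ℝ (Fin d))} {u w : EuclideanSpace ℝ (Fin d) → ℝ}
  {φ : EuclideanSpace ℝ (Fin d) → EuclideanSpace ℝ (Fin d)}

theorem totalVariation_congr_ae (h : u =ᵐ[volume.restrict Ω] w) :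
    totalVariation Ω u = totalVariation Ω w := by
  unfold totalVariation
  congr! 4 with φ _
  refine integral_congr_ae ?_
  filter_upwards [h] with x hx
  rw [hx]

theorem ofReal_integral_le_totalVariation (hφ : φ ∈ testFields Ω) :
    ENNReal.ofReal (∫ x in Ω, u x * divergence φ x) ≤ totalVariation Ω u :=
  le_iSup₂_of_le (f := fun φ _ => ENNReal.ofReal (∫ x in Ω, u x * divergence φ x)) φ hφ le_rfl

theorem totalVariation_le_ofReal {C : ℝ}
    (h : ∀ φ ∈ testFields Ω, ∫ x in Ω, u x * divergence φ x ≤ C) :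
    totalVariation Ω u ≤ ENNReal.ofReal C :=
  iSup₂_le fun φ hφ => ENNReal.ofReal_le_ofReal (h φ hφ)

theorem totalVariation_zero : totalVariation Ω (0 : EuclideanSpace ℝ (Fin d) → ℝ) = 0 := by
  simp [totalVariation]

theorem integrable_mul_divergence {μ : Measure (EuclideanSpace ℝ (Fin d))} (hu : Integrable u μ)
    (hφ : ContDiff ℝ 1 φ) (hc : HasCompactSupport φ) :
    Integrable (fun x => u x * divergence φ x) μ := by
  obtain ⟨M, -, hM⟩ := exists_abs_divergence_le hφ hc
  exact hu.mul_bdd (c := M) (continuous_divergence hφ).aestronglyMeasurable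
    (Eventually.of_forall hM)

theorem totalVariation_convex_comb_le (hu : Integrable u (volume.restrict Ω))
    (hw : Integrable w (volume.restrict Ω)) {a b : ℝ} (ha : 0 ≤ a) (hb : 0 ≤ b) :
    totalVariation Ω (fun x => a * u x + b * w x) ≤
      ENNReal.ofReal a * totalVariation Ω u + ENNReal.ofReal b * totalVariation Ω w := by
  refine iSup₂_le fun φ hφ => ?_
  have h1 := integrable_mul_divergence hu hφ.1 hφ.2.1
  have h2 := integrable_mul_divergence hw hφ.1 hφ.2.1
  have : ∫ x in Ω, (a * u x + b * w x) * divergence φ x =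
      a * (∫ x in Ω, u x * divergence φ x) + b * ∫ x in Ω, w x * divergence φ x := by
    rw [← integral_const_mul, ← integral_const_mul, ← integral_add (h1.const_mul a)
      (h2.const_mul b)]
    congr 1 with x
    ring
  rw [this]
  refine ENNReal.ofReal_add_le.trans ?_
  rw [ENNReal.ofReal_mul ha, ENNReal.ofReal_mul hb]
  gcongr <;> exact ofReal_integral_le_totalVariation hφ

theorem setIntegral_mul_divergence (hφ : tsupport φ ⊆ Ω) :
    ∫ x in Ω, u x * divergence φ x = ∫ x, u x * divergence φ x := by
  refine setIntegral_eq_integral_of_forall_compl_eq_zero fun x hx => ?_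
  rw [divergence_of_notMem_tsupport fun h => hx (hφ h), mul_zero]

/-- Test fields supported at distance at least `δ` from the complement of `Ω` can be translated by
less than `δ`. -/
theorem comp_add_right_mem_testFields {K : Set (EuclideanSpace ℝ (Fin d))} {δ : ℝ}
    (hK : Metric.thickening δ K ⊆ Ω) (hφ : φ ∈ testFields K) {z : EuclideanSpace ℝ (Fin d)}
    (hz : ‖z‖ < δ) : (fun x => φ (x + z)) ∈ testFields Ω := by
  refine ⟨hφ.1.comp (contDiff_id.add contDiff_const),
    hφ.2.1.comp_homeomorph (Homeomorph.addRight z), ?_, fun x => hφ.2.2.2 _⟩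
  have : tsupport (fun x => φ (x + z)) = (Homeomorph.addRight z) ⁻¹' tsupport φ :=
    tsupport_comp_eq_preimage φ (Homeomorph.addRight z)
  rw [this]
  intro x hx
  refine hK (Metric.mem_thickening_iff.2 ⟨x + z, hφ.2.2.1 hx, ?_⟩)
  simpa [dist_eq_norm] using hz

/-- Mollification does not increase the total variation seen by test fields supported away from
the boundary: the mollified function is an average of translates of `u`, and a translate of such a
test field is a test field. -/
theorem integral_convolution_mul_divergence_le (hΩ : MeasurableSet Ω)
    (hu : Integrable u (volume.restrict Ω)) {C : ℝ}
    (hC : ∀ φ ∈ testFields Ω, ∫ x in Ω, u x * divergence φ x ≤ C)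
    {K : Set (EuclideanSpace ℝ (Fin d))} {δ : ℝ} (hK : Metric.thickening δ K ⊆ Ω)
    (hφ : φ ∈ testFields K) (ρ : ContDiffBump (0 : EuclideanSpace ℝ (Fin d)))
    (hρ : ρ.rOut ≤ δ) :
    ∫ x, (convolution (ρ.normed volume) (Ω.indicator u) (ContinuousLinearMap.lsmul ℝ ℝ) volume) x *
      divergence φ x ≤ C := by
  set U := Ω.indicator u with hU
  have hUi : Integrable U := (integrable_indicator_iff hΩ).2 hu
  obtain ⟨M, hM0, hM⟩ := exists_abs_divergence_le hφ.1 hφ.2.1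
  have hint : Integrable (fun p : EuclideanSpace ℝ (Fin d) × EuclideanSpace ℝ (Fin d) =>
      ρ.normed volume p.2 * U (p.1 - p.2) * divergence φ p.1) (volume.prod volume) := by
    have := (ρ.integrable_normed (μ := volume)).convolution_integrand
      (ContinuousLinearMap.lsmul ℝ ℝ) hUi
    refine Integrable.mul_bdd (c := M) (by simpa using this) ?_ (Eventually.of_forall fun p => hM p.1)
    exact ((continuous_divergence hφ.1).comp continuous_fst).aestronglyMeasurable
  have hswap : ∫ x, (convolution (ρ.normed volume) U (ContinuousLinearMap.lsmul ℝ ℝ) volume) x *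
      divergence φ x =
      ∫ z, ρ.normed volume z * ∫ x, U (x - z) * divergence φ x := by
    simp only [convolution_def, ContinuousLinearMap.lsmul_apply, smul_eq_mul,
      ← integral_mul_const, ← integral_const_mul]
    rw [integral_integral_swap hint]
    simp only [mul_assoc]
  have hinner : ∀ z, ρ.normed volume z * ∫ x, U (x - z) * divergence φ x ≤
      ρ.normed volume z * C := by
    intro z
    by_cases hz : z ∈ Metric.ball 0 ρ.rOut
    · refine mul_le_mul_of_nonneg_left ?_ (ρ.nonneg_normed z)
      have hmem := comp_add_right_mem_testFields hK hφ
        (z := z) ((mem_ball_zero_iff.1 hz).trans_le hρ)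
      refine le_trans (le_of_eq ?_) (hC _ hmem)
      rw [← integral_add_right_eq_self _ z, ← integral_indicator hΩ]
      congr 1 with x
      rw [add_sub_cancel_right, Set.indicator_mul_left, divergence_comp_add_right]
    · rw [← ρ.support_normed_eq (μ := volume), Function.notMem_support] at hz
      simp [hz]
  have hint2 := hint.swap.integral_prod_left
  rw [hswap]
  calc _ ≤ ∫ z, ρ.normed volume z * C := by
        refine integral_mono ?_ (ρ.integrable_normed.mul_const C) hinner
        convert! hint2 using 2 with z
        simp [← integral_const_mul, mul_assoc]
    _ = C := by rw [integral_mul_const, ρ.integral_normed, one_mul]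

/-- The chain rule moves a smooth `T` from the function to the test field:
`-∇(T ∘ v) · φ = -∇v · (T' ∘ v) φ`. -/
theorem exists_integral_comp_mul_divergence_eq {T : ℝ → ℝ} (hT : ContDiff ℝ 2 T)
    (hT0 : ∀ t, 0 ≤ deriv T t) (hT1 : ∀ t, deriv T t ≤ 1)
    {v : EuclideanSpace ℝ (Fin d) → ℝ} (hv : ContDiff ℝ 1 v) (hφ : φ ∈ testFields Ω) :
    ∃ ψ ∈ testFields (tsupport φ),
      ∫ x, T (v x) * divergence φ x = ∫ x, v x * divergence ψ x := by
  have hTd : Differentiable ℝ T := hT.differentiable two_ne_zero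
  have hT' : ContDiff ℝ 1 (deriv T) := by
    have : ContDiff ℝ (1 + 1) T := by simpa [one_add_one_eq_two] using hT
    exact (contDiff_succ_iff_deriv.1 this).2.2
  have hTv : ContDiff ℝ 1 fun x => T (v x) := (hT.of_le one_le_two).comp hv
  have hTv' : ContDiff ℝ 1 fun x => deriv T (v x) := hT'.comp hv
  have hψ : (fun x => deriv T (v x) • φ x) ∈ testFields (tsupport φ) := by
    have h1 : ContDiff ℝ 1 fun x => deriv T (v x) • φ x := hTv'.smul hφ.1
    have h2 : HasCompactSupport fun x => deriv T (v x) • φ x :=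
      hφ.2.1.smul_left (f := fun x => deriv T (v x))
    have h3 : tsupport (fun x => deriv T (v x) • φ x) ⊆ tsupport φ :=
      tsupport_smul_subset_right (fun x => deriv T (v x)) φ
    refine ⟨h1, h2, h3, fun x => ?_⟩
    rw [norm_smul, Real.norm_of_nonneg (hT0 _)]
    exact mul_le_one₀ (hT1 _) (norm_nonneg _) (hφ.2.2.2 x)
  refine ⟨_, hψ, ?_⟩
  rw [integral_mul_divergence hTv hφ.1 hφ.2.1, integral_mul_divergence hv hψ.1 hψ.2.1]
  congr 2 with x
  have h2 : HasFDerivAt (fun x => T (v x)) (deriv T (v x) • fderiv ℝ v x) x :=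
    (hTd _).hasDerivAt.comp_hasFDerivAt x (hv.differentiable one_ne_zero x).hasFDerivAt
  rw [h2.fderiv]
  simp

/-- The chain rule inequality `|D(T ∘ u)|(Ω) ≤ |Du|(Ω)` for a bounded, `C²`, nondecreasing,
nonexpansive `T`, obtained from the smooth case by mollification. -/
theorem totalVariation_comp_le (hΩ : IsOpen Ω) (hu : Integrable u (volume.restrict Ω))
    {T : ℝ → ℝ} (hT : ContDiff ℝ 2 T) (hT0 : ∀ t, 0 ≤ deriv T t) (hT1 : ∀ t, deriv T t ≤ 1)
    {B : ℝ} (hB : ∀ t, |T t| ≤ B) : totalVariation Ω (T ∘ u) ≤ totalVariation Ω u := by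
  by_cases htop : totalVariation Ω u = ∞
  · simp [htop]
  set C := (totalVariation Ω u).toReal with hCdef
  have hC : ∀ φ ∈ testFields Ω, ∫ x in Ω, u x * divergence φ x ≤ C := fun φ hφ =>
    (ENNReal.ofReal_le_iff_le_toReal htop).1 (ofReal_integral_le_totalVariation hφ)
  rw [← ENNReal.ofReal_toReal htop]
  refine totalVariation_le_ofReal fun φ hφ => ?_
  obtain ⟨δ, hδ, hthick⟩ := (IsCompact.exists_thickening_subset_open hφ.2.1 hΩ hφ.2.2.1)
  set U := Ω.indicator u with hU
  have hUi : Integrable U := (integrable_indicator_iff hΩ.measurableSet).2 hu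
  let ρ : ℕ → ContDiffBump (0 : EuclideanSpace ℝ (Fin d)) := fun n =>
    ⟨δ / (n + 1) / 2, δ / (n + 1), by positivity, half_lt_self (by positivity)⟩
  have hρle : ∀ n, (ρ n).rOut ≤ δ := fun n =>
    div_le_self hδ.le (by linarith [(Nat.cast_nonneg n : (0 : ℝ) ≤ n)])
  have hρ0 : Tendsto (fun n => (ρ n).rOut) atTop (𝓝 0) := by
    have := (tendsto_one_div_add_atTop_nhds_zero_nat (𝕜 := ℝ)).const_mul δ
    simpa [ρ, div_eq_mul_inv] using this
  let U' : ℕ → EuclideanSpace ℝ (Fin d) → ℝ := fun n =>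
    convolution ((ρ n).normed volume) U (ContinuousLinearMap.lsmul ℝ ℝ) volume
  have hU'smooth : ∀ n, ContDiff ℝ 1 (U' n) := fun n =>
    (ρ n).hasCompactSupport_normed.contDiff_convolution_left _ ((ρ n).contDiff_normed (n := 1))
      hUi.locallyIntegrable
  have hU'lim : ∀ᵐ x, Tendsto (fun n => U' n x) atTop (𝓝 (U x)) :=
    ContDiffBump.ae_convolution_tendsto_right_of_locallyIntegrable (K := 2) hρ0
      (Eventually.of_forall fun n => by simp [ρ]; linarith) hUi.locallyIntegrable
  have hbound : ∀ n, ∫ x, T (U' n x) * divergence φ x ≤ C := by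
    intro n
    obtain ⟨ψ, hψ, h⟩ := exists_integral_comp_mul_divergence_eq hT hT0 hT1 (hU'smooth n) hφ
    rw [h]
    exact integral_convolution_mul_divergence_le hΩ.measurableSet hu hC hthick hψ (ρ n) (hρle n)
  have hdiv := continuous_divergence hφ.1
  have hlim : Tendsto (fun n => ∫ x, T (U' n x) * divergence φ x) atTop
      (𝓝 (∫ x, T (U x) * divergence φ x)) := by
    refine tendsto_integral_of_dominated_convergence (fun x => B * |divergence φ x|) ?_ ?_ ?_ ?_
    · intro n
      have := (hU'smooth n).continuous
      have := hT.continuous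
      exact Continuous.aestronglyMeasurable (by fun_prop)
    · exact ((hdiv.integrable_of_hasCompactSupport
        (hasCompactSupport_divergence hφ.2.1)).abs).const_mul B
    · intro n
      refine Eventually.of_forall fun x => ?_
      rw [norm_mul]
      exact mul_le_mul_of_nonneg_right (hB _) (abs_nonneg _)
    · filter_upwards [hU'lim] with x hx
      exact ((hT.continuous.tendsto _).comp hx).mul_const _
  have hle := le_of_tendsto' hlim hbound
  rw [← setIntegral_mul_divergence (u := fun x => T (U x)) hφ.2.2.1] at hle
  refine le_trans (le_of_eq ?_) hle
  refine setIntegral_congr_fun hΩ.measurableSet fun x hx => ?_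
  simp [hU, hx]

end TotalVariation

/-! ### A smooth truncation -/

/-- A bounded, smooth, nondecreasing, nonexpansive function which is the identity on `[0, 1]`: the
primitive of a bump function. -/
theorem exists_smooth_truncation : ∃ (T : ℝ → ℝ) (B : ℝ), ContDiff ℝ 2 T ∧
    (∀ t, 0 ≤ deriv T t) ∧ (∀ t, deriv T t ≤ 1) ∧ (∀ t, |T t| ≤ B) ∧
    (∀ t, 0 ≤ t → t ≤ 1 → T t = t) ∧ ∀ s t, |T s - T t| ≤ |s - t| := by
  let χ : ContDiffBump (0 : ℝ) := ⟨1, 2, one_pos, one_lt_two⟩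
  have hχ : Continuous χ := χ.continuous
  have hd : ∀ t, HasDerivAt (fun t => ∫ s in (0 : ℝ)..t, χ s) (χ t) t := fun t =>
    intervalIntegral.integral_hasDerivAt_right (hχ.intervalIntegrable _ _)
      (hχ.stronglyMeasurableAtFilter _ _) hχ.continuousAt
  have hderiv : deriv (fun t => ∫ s in (0 : ℝ)..t, χ s) = χ := funext fun t => (hd t).deriv
  refine ⟨fun t => ∫ s in (0 : ℝ)..t, χ s, ∫ s, |χ s|, ?_, ?_, ?_, ?_, ?_, ?_⟩
  · rw [← one_add_one_eq_two]
    refine contDiff_succ_iff_deriv.2 ⟨fun t => (hd t).differentiableAt, by simp, ?_⟩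
    rw [hderiv]
    exact χ.contDiff
  · intro t
    rw [hderiv]
    exact χ.nonneg
  · intro t
    rw [hderiv]
    exact χ.le_one
  · intro t
    refine (intervalIntegral.norm_integral_le_integral_norm_uIoc (f := χ) (a := 0) (b := t)
      (μ := volume)).trans ?_
    exact setIntegral_le_integral (χ.integrable (μ := volume)).norm
      (Eventually.of_forall fun _ => norm_nonneg _)
  · intro t h0 h1
    have : ∫ s in (0 : ℝ)..t, χ s = ∫ s in (0 : ℝ)..t, (1 : ℝ) := by
      refine intervalIntegral.integral_congr fun s hs => χ.one_of_mem_closedBall ?_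
      rw [Set.uIcc_of_le h0] at hs
      simp only [Metric.mem_closedBall, dist_zero_right, Real.norm_eq_abs]
      exact abs_le.2 ⟨by linarith [hs.1], hs.2.trans h1⟩
    simp [this]
  · intro s t
    have := Convex.norm_image_sub_le_of_norm_hasDerivWithin_le (C := 1) (s := Set.univ)
      (fun x _ => (hd x).hasDerivWithinAt)
      (fun x _ => by rw [Real.norm_of_nonneg χ.nonneg]; exact χ.le_one)
      convex_univ (Set.mem_univ t) (Set.mem_univ s)
    simpa using this

/-! ### A calibrated function -/

/-- A calibration criterion: if `φ` is pointwise the direction of steepest descent of `f`, it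
attains the supremum which defines the total variation of `f`. -/
theorem totalVariation_eq_of_calibrated {d : ℕ} {Ω : Set (EuclideanSpace ℝ (Fin d))}
    {f : EuclideanSpace ℝ (Fin d) → ℝ} (hf : ContDiff ℝ 1 f)
    (hdf : HasCompactSupport (fderiv ℝ f))
    {φ : EuclideanSpace ℝ (Fin d) → EuclideanSpace ℝ (Fin d)} (hφ : φ ∈ testFields Ω)
    (h : ∀ x w, ‖w‖ ≤ 1 → -fderiv ℝ f x w ≤ -fderiv ℝ f x (φ x)) :
    totalVariation Ω f = ENNReal.ofReal (∫ x in Ω, f x * divergence φ x) := by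
  refine le_antisymm (totalVariation_le_ofReal fun ψ hψ => ?_)
    (ofReal_integral_le_totalVariation hφ)
  have hint : ∀ ψ ∈ testFields Ω, Integrable fun x => fderiv ℝ f x (ψ x) := by
    intro ψ hψ
    have h1 := hf.continuous_fderiv one_ne_zero
    have h2 := hψ.1.continuous
    refine Continuous.integrable_of_hasCompactSupport (by fun_prop) (hdf.mono fun x hx h0 => ?_)
    simp [h0] at hx
  rw [setIntegral_mul_divergence hφ.2.2.1, setIntegral_mul_divergence hψ.2.2.1,
    integral_mul_divergence hf hφ.1 hφ.2.1, integral_mul_divergence hf hψ.1 hψ.2.1,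
    ← integral_neg, ← integral_neg]
  exact integral_mono (hint ψ hψ).neg (hint φ hφ).neg fun x => h x _ (hψ.2.2.2 x)

/-- Every nonempty open set carries a smooth function `f` with values in `[0, 1]` and positive total
variation, and a test field `φ` at which the supremum defining the total variation of `f` is
attained. Here `f` is a radial plateau, decreasing in an annulus, and `φ` is the unit radial field
on this annulus, cut off smoothly away from it. -/
theorem exists_calibrated {d : ℕ} (hd : 1 ≤ d) {Ω : Set (EuclideanSpace ℝ (Fin d))}
    (hΩ : IsOpen Ω) (hne : Ω.Nonempty) :
    ∃ (f : EuclideanSpace ℝ (Fin d) → ℝ)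
      (φ : EuclideanSpace ℝ (Fin d) → EuclideanSpace ℝ (Fin d)),
      Continuous f ∧ (∀ x, 0 ≤ f x) ∧ (∀ x, f x ≤ 1) ∧ φ ∈ testFields Ω ∧
      totalVariation Ω f = ENNReal.ofReal (∫ x in Ω, f x * divergence φ x) ∧
      0 < ∫ x in Ω, f x * divergence φ x := by
  obtain ⟨x₀, hx₀⟩ := hne
  obtain ⟨ε, hε, hball⟩ := Metric.isOpen_iff.1 hΩ x₀ hx₀
  obtain ⟨r, hr, rfl⟩ : ∃ r, 0 < r ∧ ε = 2 * r := ⟨ε / 2, by positivity, by ring⟩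
  -- `σ` is the squared rescaled distance to the centre; the annulus is `1 ≤ σ ≤ 2`
  set σ : EuclideanSpace ℝ (Fin d) → ℝ := fun x => ‖x - x₀‖ ^ 2 / r ^ 2 with hσ
  have hσd : ContDiff ℝ 1 σ := ((contDiff_id.sub contDiff_const).norm_sq ℝ).div_const _
  have hσsqrt : ∀ x, √(σ x) = r⁻¹ * ‖x - x₀‖ := by
    intro x
    rw [hσ]
    dsimp only
    rw [← div_pow, Real.sqrt_sq (by positivity), div_eq_inv_mul]
  have hσfd : ∀ x, HasFDerivAt σ ((r ^ 2)⁻¹ • (2 : ℝ) • innerSL ℝ (x - x₀)) x := by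
    intro x
    have h1 : HasFDerivAt (fun x => ‖x - x₀‖ ^ 2) ((2 : ℝ) • innerSL ℝ (x - x₀)) x := by
      have h2 := ((hasFDerivAt_id (𝕜 := ℝ) x).sub_const x₀).norm_sq
      convert! h2 using 1
      ext w
      simp
    have h3 := h1.const_smul ((r ^ 2)⁻¹)
    convert! h3 using 1
    ext y
    simp [hσ, div_eq_inv_mul]
  set g : ℝ → ℝ := fun s => Real.smoothTransition (2 - s) with hg
  have hgd : ContDiff ℝ 1 g :=
    Real.smoothTransition.contDiff.comp (contDiff_const.sub contDiff_id)
  have hganti : Antitone g := fun a b hab => Real.smoothTransition.monotone (by linarith)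
  have hg' : ∀ s, deriv g s ≤ 0 := fun s => hganti.deriv_nonpos
  have hg'0 : ∀ s, s < 1 ∨ 2 < s → deriv g s = 0 := by
    rintro s (hs | hs)
    · have : g =ᶠ[𝓝 s] fun _ => 1 := by
        filter_upwards [gt_mem_nhds hs] with t ht
        exact Real.smoothTransition.one_of_one_le (by linarith)
      rw [this.deriv_eq, deriv_const]
    · have : g =ᶠ[𝓝 s] fun _ => 0 := by
        filter_upwards [lt_mem_nhds hs] with t ht
        exact Real.smoothTransition.zero_of_nonpos (by linarith)
      rw [this.deriv_eq, deriv_const]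
  let τ : ContDiffBump (3 / 2 : ℝ) := ⟨1 / 2, 1, by norm_num, by norm_num⟩
  have hτ1 : ∀ s, 1 ≤ s → s ≤ 2 → τ s = 1 := fun s h1 h2 => τ.one_of_mem_closedBall (by
    rw [Metric.mem_closedBall, Real.dist_eq, abs_le]
    constructor <;> norm_num [τ] <;> linarith)
  have hτ0 : ∀ s, s ≤ 1 / 2 ∨ 5 / 2 ≤ s → τ s = 0 := fun s h => τ.zero_of_le_dist (by
    rw [Real.dist_eq, le_abs]
    rcases h with h | h
    · right; norm_num [τ]; linarith
    · left; norm_num [τ]; linarith)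
  set θ : ℝ → ℝ := fun s => τ s / √s with hθ
  have hθd : ContDiff ℝ 1 θ := by
    refine contDiff_iff_contDiffAt.2 fun s => ?_
    rcases lt_or_ge s (1 / 2) with hs | hs
    · have : θ =ᶠ[𝓝 s] fun _ => 0 := by
        filter_upwards [gt_mem_nhds hs] with t ht
        simp [hθ, hτ0 t (Or.inl (le_of_lt ht))]
      exact contDiffAt_const.congr_of_eventuallyEq this
    · have hs0 : 0 < s := by linarith
      exact τ.contDiffAt.div (contDiffAt_id.sqrt hs0.ne') (Real.sqrt_pos.2 hs0).ne'
  set f : EuclideanSpace ℝ (Fin d) → ℝ := fun x => g (σ x) with hf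
  set φ : EuclideanSpace ℝ (Fin d) → EuclideanSpace ℝ (Fin d) :=
    fun x => θ (σ x) • r⁻¹ • (x - x₀) with hφ
  have hfd : ContDiff ℝ 1 f := hgd.comp hσd
  have hffd : ∀ x w, fderiv ℝ f x w =
      deriv g (σ x) * ((r ^ 2)⁻¹ * (2 * inner ℝ (x - x₀) w)) := by
    intro x w
    have := ((hgd.differentiable one_ne_zero (σ x)).hasDerivAt).comp_hasFDerivAt x (hσfd x)
    have h2 : fderiv ℝ f x = _ := this.fderiv
    rw [h2]
    rfl
  have hφd : ContDiff ℝ 1 φ :=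
    (hθd.comp hσd).smul ((contDiff_id.sub contDiff_const).const_smul _)
  have hfar : ∀ x, x ∉ Metric.closedBall x₀ (9 / 5 * r) → 5 / 2 < σ x := by
    intro x hx
    rw [Metric.mem_closedBall, dist_eq_norm, not_le] at hx
    rw [hσ]
    dsimp only
    rw [lt_div_iff₀ (by positivity)]
    nlinarith
  have hφsupp : Function.support φ ⊆ Metric.closedBall x₀ (9 / 5 * r) := by
    intro x hx
    by_contra hx'
    exact hx (by simp [hφ, hθ, hτ0 _ (Or.inr (hfar x hx').le)])
  have hφc : HasCompactSupport φ :=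
    HasCompactSupport.of_support_subset_isCompact (isCompact_closedBall _ _) hφsupp
  have hφt : tsupport φ ⊆ Ω :=
    (closure_minimal hφsupp Metric.isClosed_closedBall).trans
      ((Metric.closedBall_subset_ball (by linarith)).trans hball)
  have hφn : ∀ x, ‖φ x‖ ≤ 1 := by
    intro x
    have h1 : ‖φ x‖ = τ (σ x) / √(σ x) * √(σ x) := by
      rw [hφ, hσsqrt]
      dsimp only
      rw [norm_smul, norm_smul, Real.norm_of_nonneg (inv_nonneg.2 hr.le), Real.norm_of_nonneg
        (div_nonneg τ.nonneg (Real.sqrt_nonneg _)), hσsqrt]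
    rw [h1]
    rcases eq_or_ne √(σ x) 0 with h | h
    · simp [h]
    · rw [div_mul_cancel₀ _ h]
      exact τ.le_one
  have hφmem : φ ∈ testFields Ω := ⟨hφd, hφc, hφt, hφn⟩
  have hcal : ∀ x w, ‖w‖ ≤ 1 → -fderiv ℝ f x w ≤ -fderiv ℝ f x (φ x) := by
    intro x w hw
    rw [hffd, hffd]
    by_cases hs : 1 ≤ σ x ∧ σ x ≤ 2
    · have h1 : inner ℝ (x - x₀) w ≤ ‖x - x₀‖ :=
        (real_inner_le_norm _ _).trans (mul_le_of_le_one_right (norm_nonneg _) hw)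
      have hpos : 0 < ‖x - x₀‖ := by
        have := Real.sqrt_pos.2 (zero_lt_one.trans_le hs.1)
        rw [hσsqrt] at this
        exact pos_of_mul_pos_right this (inv_nonneg.2 hr.le)
      have h2 : inner ℝ (x - x₀) (φ x) = ‖x - x₀‖ := by
        rw [hφ]
        dsimp only
        rw [hθ]
        dsimp only
        rw [inner_smul_right, inner_smul_right, real_inner_self_eq_norm_sq, hτ1 _ hs.1 hs.2, hσsqrt]
        field_simp
      rw [h2, ← neg_mul, ← neg_mul]
      have := hg' (σ x)
      gcongr
      linarith
    · have : deriv g (σ x) = 0 := hg'0 _ (by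
        by_contra! h
        exact hs h)
      simp [this]
  have hdfc : HasCompactSupport (fderiv ℝ f) := by
    refine HasCompactSupport.intro (isCompact_closedBall x₀ (9 / 5 * r)) fun x hx => ?_
    ext w
    rw [hffd, hg'0 _ (Or.inr (by linarith [hfar x hx]))]
    simp
  refine ⟨f, φ, hfd.continuous, fun x => Real.smoothTransition.nonneg _,
    fun x => Real.smoothTransition.le_one _, hφmem,
    totalVariation_eq_of_calibrated hfd hdfc hφmem hcal, ?_⟩
  rw [setIntegral_mul_divergence hφt, integral_mul_divergence hfd hφd hφc, ← integral_neg]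
  have hcont := hfd.continuous_fderiv one_ne_zero
  have hφcont := hφd.continuous
  obtain ⟨x, hx⟩ : ∃ x, -fderiv ℝ f x (φ x) ≠ 0 := by
    by_contra! hall
    have hzero : ∀ x, fderiv ℝ f x = 0 := by
      intro x
      have key : ∀ w : EuclideanSpace ℝ (Fin d), ‖w‖ ≤ 1 → fderiv ℝ f x w = 0 := by
        intro w hw
        have h1 := hcal x w hw
        have h2 := hcal x (-w) (by rwa [norm_neg])
        rw [hall x] at h1 h2
        rw [map_neg] at h2
        linarith
      refine ContinuousLinearMap.coe_injective
        ((EuclideanSpace.basisFun (Fin d) ℝ).toBasis.ext fun i => ?_)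
      exact key _ (by simp)
    have hconst := is_const_of_fderiv_eq_zero (hfd.differentiable one_ne_zero) hzero x₀
      (x₀ + EuclideanSpace.single ⟨0, hd⟩ (2 * r))
    have h1 : f x₀ = 1 := Real.smoothTransition.one_of_one_le (by simp [hσ])
    have h0 : f (x₀ + EuclideanSpace.single ⟨0, hd⟩ (2 * r)) = 0 := by
      refine Real.smoothTransition.zero_of_nonpos ?_
      simp only [hσ, add_sub_cancel_left, PiLp.norm_single, Real.norm_eq_abs, sq_abs,
        mul_pow]
      rw [mul_div_assoc, div_self (by positivity)]
      norm_num
    rw [h1, h0] at hconst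
    exact one_ne_zero hconst
  refine Continuous.integral_pos_of_hasCompactSupport_nonneg_nonzero (by fun_prop) ?_ ?_ hx
  · refine hφc.mono fun y hy h0 => ?_
    simp [h0] at hy
  · intro y
    simpa using hcal y 0 (by simp)

section Fidelity

variable {d : ℕ} {Ω : Set (EuclideanSpace ℝ (Fin d))} {f u : EuclideanSpace ℝ (Fin d) → ℝ}
  {l₁ l₂ : ℝ≥0}

/-! ### The fidelity as a Huber integral -/

theorem eLpNorm_two_sq_eq_lintegral {α : Type*} [MeasurableSpace α] (μ : Measure α) (g : α → ℝ) :
    eLpNorm g 2 μ ^ 2 = ∫⁻ x, ‖g x‖ₑ ^ 2 ∂μ := by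
  have := eLpNorm_nnreal_pow_eq_lintegral (f := g) (μ := μ) (p := 2) two_ne_zero
  simpa using this

theorem integrable_huber {μ : Measure (EuclideanSpace ℝ (Fin d))} (h₁ : 0 ≤ (l₁ : ℝ))
    (h₂ : 0 < l₂) {g : EuclideanSpace ℝ (Fin d) → ℝ} (hg : Integrable g μ) :
    Integrable (fun x => huber l₁ l₂ (g x)) μ := by
  have h₂' : 0 < (l₂ : ℝ) := NNReal.coe_pos.2 h₂
  refine (hg.abs.const_mul (l₁ : ℝ)).mono'
    (continuous_huber.comp_aestronglyMeasurable hg.aestronglyMeasurable)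
    (Eventually.of_forall fun x => ?_)
  rw [Real.norm_of_nonneg (huber_nonneg h₁ h₂' _)]
  exact huber_le_mul_abs h₁ h₂' _

theorem icFidelity_eq_ofReal_integral_huber (h₂ : 0 < l₂)
    (hf : Integrable f (volume.restrict Ω)) (hu : Integrable u (volume.restrict Ω)) :
    icFidelity Ω l₁ l₂ u f = ENNReal.ofReal (∫ x in Ω, huber l₁ l₂ (f x - u x)) := by
  have h₁ : 0 ≤ (l₁ : ℝ) := l₁.coe_nonneg
  have h₂' : 0 < (l₂ : ℝ) := NNReal.coe_pos.2 h₂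
  have hg : Integrable (fun x => f x - u x) (volume.restrict Ω) := hf.sub hu
  have key : ∀ v : EuclideanSpace ℝ (Fin d) → ℝ, MemLp v 1 (volume.restrict Ω) →
      (l₁ : ℝ≥0∞) * eLpNorm v 1 (volume.restrict Ω) +
        (l₂ : ℝ≥0∞) / 2 * eLpNorm (f - u - v) 2 (volume.restrict Ω) ^ 2 =
      ∫⁻ x in Ω, ENNReal.ofReal (splitCost l₁ l₂ (f x - u x) (v x)) := by
    intro v hv
    have hm1 : AEMeasurable (fun x => ‖v x‖ₑ) (volume.restrict Ω) := hv.1.enorm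
    have hm2 : AEMeasurable (fun x => ‖(f - u - v) x‖ₑ ^ 2) (volume.restrict Ω) :=
      ((hf.1.sub hu.1).sub hv.1).enorm.pow_const 2
    rw [eLpNorm_one_eq_lintegral_enorm, eLpNorm_two_sq_eq_lintegral, ← lintegral_const_mul'' _ hm1,
      ← lintegral_const_mul'' _ hm2, ← lintegral_add_left' (hm1.const_mul _)]
    refine lintegral_congr fun x => ?_
    rw [splitCost, ENNReal.ofReal_add (by positivity) (by positivity), ENNReal.ofReal_mul h₁,
      ENNReal.ofReal_mul (by positivity), ENNReal.ofReal_coe_nnreal,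
      ENNReal.ofReal_div_of_pos two_pos, ENNReal.ofReal_coe_nnreal, ENNReal.ofReal_ofNat,
      ← Real.enorm_eq_ofReal_abs, ← sq_abs, ENNReal.ofReal_pow (abs_nonneg _),
      ← Real.enorm_eq_ofReal_abs]
    rfl
  rw [ofReal_integral_eq_lintegral_ofReal (integrable_huber h₁ h₂ hg)
    (Eventually.of_forall fun x => huber_nonneg h₁ h₂' _)]
  refine le_antisymm ?_ (le_iInf₂ fun v hv => ?_)
  · refine iInf₂_le_of_le (fun x => softThreshold l₁ l₂ (f x - u x)) ?_ (key _ ?_).le <;>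
    · rw [memLp_one_iff_integrable]
      exact hg.mono (continuous_softThreshold.comp_aestronglyMeasurable hg.1)
        (Eventually.of_forall fun x => abs_softThreshold_le h₁ h₂' _)
  · rw [key v hv]
    exact lintegral_mono fun x => ENNReal.ofReal_le_ofReal (huber_le_splitCost h₁ h₂' _ _)

theorem energy_eq (h₂ : 0 < l₂)
    (hf : Integrable f (volume.restrict Ω)) (hu : Integrable u (volume.restrict Ω)) :
    energy Ω f l₁ l₂ u =
      totalVariation Ω u + ENNReal.ofReal (∫ x in Ω, huber l₁ l₂ (f x - u x)) := by
  rw [energy, icFidelity_eq_ofReal_integral_huber h₂ hf hu]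

theorem icFidelity_le : icFidelity Ω l₁ l₂ u f ≤
    (l₂ : ℝ≥0∞) / 2 * eLpNorm (f - u) 2 (volume.restrict Ω) ^ 2 :=
  (iInf₂_le (0 : EuclideanSpace ℝ (Fin d) → ℝ) MemLp.zero).trans (by simp)

end Fidelity

/-! ### Existence of lower level minimisers -/

section Existence

variable {d : ℕ} {Ω : Set (EuclideanSpace ℝ (Fin d))} {f u : EuclideanSpace ℝ (Fin d) → ℝ}
  {l₁ l₂ : ℝ≥0}

/-- An integral functional whose integrand is uniformly Lipschitz in the value of the function is
continuous on `L²` of a finite measure. -/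
theorem continuous_integral_Lp_two {α : Type*} [MeasurableSpace α] {μ : Measure α}
    [IsFiniteMeasure μ] {k : α → ℝ → ℝ} {L : ℝ} (hL : ∀ x s t, |k x s - k x t| ≤ L * |s - t|)
    (hint : ∀ U : Lp ℝ 2 μ, Integrable (fun x => k x (U x)) μ) :
    Continuous fun U : Lp ℝ 2 μ => ∫ x, k x (U x) ∂μ := by
  have hint1 : ∀ U : Lp ℝ 2 μ, Integrable U μ := fun U =>
    (Lp.memLp U).integrable one_le_two
  have hnorm : ∀ W : Lp ℝ 2 μ, ∫ x, |W x| ∂μ ≤ ‖W‖ * ((μ Set.univ) ^ (1 / 2 : ℝ)).toReal := by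
    intro W
    have h1 : ∫ x, |W x| ∂μ = (eLpNorm W 1 μ).toReal := by
      rw [eLpNorm_one_eq_lintegral_enorm]
      exact integral_norm_eq_lintegral_enorm (Lp.aestronglyMeasurable W)
    have h2 := eLpNorm_le_eLpNorm_mul_rpow_measure_univ (one_le_two : (1 : ℝ≥0∞) ≤ 2)
      (Lp.aestronglyMeasurable W)
    rw [h1, Lp.norm_def, ← ENNReal.toReal_mul]
    refine ENNReal.toReal_mono (ENNReal.mul_ne_top (Lp.eLpNorm_ne_top W) ?_) ?_
    · exact ENNReal.rpow_ne_top_of_nonneg (by norm_num) (measure_ne_top μ _)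
    · convert! h2 using 3
      norm_num
  refine continuous_iff_continuousAt.2 fun V => ?_
  rw [ContinuousAt, tendsto_iff_norm_sub_tendsto_zero]
  have hlim : Tendsto (fun U : Lp ℝ 2 μ =>
      |L| * (‖U - V‖ * ((μ Set.univ) ^ (1 / 2 : ℝ)).toReal)) (𝓝 V) (𝓝 0) := by
    have : Continuous fun U : Lp ℝ 2 μ =>
      |L| * (‖U - V‖ * ((μ Set.univ) ^ (1 / 2 : ℝ)).toReal) := by fun_prop
    simpa using this.tendsto V
  refine squeeze_zero (fun _ => norm_nonneg _) (fun U => ?_) hlim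
  rw [← integral_sub (hint U) (hint V)]
  refine (norm_integral_le_integral_norm _).trans ?_
  refine le_trans ?_ (mul_le_mul_of_nonneg_left (hnorm (U - V)) (abs_nonneg L))
  rw [← integral_const_mul]
  refine integral_mono_ae ((hint U).sub (hint V)).norm ((hint1 _).abs.const_mul _) ?_
  filter_upwards [Lp.coeFn_sub U V] with x hx
  rw [hx]
  refine (hL x _ _).trans ?_
  exact mul_le_mul_of_nonneg_right (le_abs_self L) (abs_nonneg _)

theorem integrable_of_forall_abs_le {α : Type*} [MeasurableSpace α] {μ : Measure α}
    [IsFiniteMeasure μ] {g : α → ℝ} (hg : AEStronglyMeasurable g μ) {B : ℝ}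
    (hB : ∀ x, |g x| ≤ B) : Integrable g μ :=
  Integrable.of_bound hg B (Eventually.of_forall hB)

theorem comp_mem_BV (hΩ : IsOpen Ω) (hu : u ∈ BV Ω) [IsFiniteMeasure (volume.restrict Ω)]
    {T : ℝ → ℝ} (hT : ContDiff ℝ 2 T) (hT0 : ∀ t, 0 ≤ deriv T t) (hT1 : ∀ t, deriv T t ≤ 1)
    {B : ℝ} (hB : ∀ t, |T t| ≤ B) : T ∘ u ∈ BV Ω :=
  ⟨memLp_one_iff_integrable.2 (integrable_of_forall_abs_le
      (hT.continuous.comp_aestronglyMeasurable hu.1.1) fun _ => hB _),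
    (totalVariation_comp_le hΩ (memLp_one_iff_integrable.1 hu.1) hT hT0 hT1 hB).trans_lt hu.2⟩

/-- Truncating to a range which contains that of `f` does not increase the Huber fidelity. -/
theorem huber_sub_comp_le (h₁ : 0 < l₁) (h₂ : 0 < l₂) (hf0 : ∀ x, 0 ≤ f x) (hf1 : ∀ x, f x ≤ 1)
    {T : ℝ → ℝ} (hTid : ∀ t, 0 ≤ t → t ≤ 1 → T t = t) (hTlip : ∀ s t, |T s - T t| ≤ |s - t|)
    (x : EuclideanSpace ℝ (Fin d)) :
    huber l₁ l₂ (f x - (T ∘ u) x) ≤ huber l₁ l₂ (f x - u x) := by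
  refine huber_le_of_abs_le (NNReal.coe_pos.2 h₁) (NNReal.coe_pos.2 h₂) ?_
  have := hTlip (f x) (u x)
  rwa [hTid _ (hf0 x) (hf1 x)] at this

/-- The direct method in `L²(Ω)`: truncation confines the competitors to a ball of `L²(Ω)`, on
which the energy is convex and lower semicontinuous. -/
theorem lowerArgmin_nonempty (hΩ : IsOpen Ω) [IsFiniteMeasure (volume.restrict Ω)]
    (hf : Continuous f) (hf0 : ∀ x, 0 ≤ f x) (hf1 : ∀ x, f x ≤ 1) (h₁ : 0 < l₁) (h₂ : 0 < l₂) :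
    (lowerArgmin Ω f l₁ l₂).Nonempty := by
  have h₁' : 0 < (l₁ : ℝ) := NNReal.coe_pos.2 h₁
  have h₂' : 0 < (l₂ : ℝ) := NNReal.coe_pos.2 h₂
  set μ := volume.restrict Ω with hμ
  have hfi : Integrable f μ := integrable_of_forall_abs_le hf.aestronglyMeasurable
    fun x => by rw [abs_of_nonneg (hf0 x)]; exact hf1 x
  obtain ⟨T, B, hT, hT0, hT1, hB, hTid, hTlip⟩ := exists_smooth_truncation
  have hint1 : ∀ U : Lp ℝ 2 μ, Integrable U μ := fun U => (Lp.memLp U).integrable one_le_two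
  set E : Lp ℝ 2 μ → ℝ≥0∞ := fun U =>
    totalVariation Ω U + ENNReal.ofReal (∫ x in Ω, huber l₁ l₂ (f x - U x)) with hE
  have hhub : ∀ U : Lp ℝ 2 μ, Integrable (fun x => huber l₁ l₂ (f x - U x)) μ := fun U =>
    integrable_huber h₁'.le h₂ (hfi.sub (hint1 U))
  have hlsc : LowerSemicontinuous E := by
    refine LowerSemicontinuous.add ?_ ?_
    · refine lowerSemicontinuous_biSup fun φ hφ => ?_
      obtain ⟨M, -, hM⟩ := exists_abs_divergence_le hφ.1 hφ.2.1
      refine (ENNReal.continuous_ofReal.comp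
        (continuous_integral_Lp_two (k := fun x t => t * divergence φ x) (L := M) ?_
          fun U => integrable_mul_divergence (hint1 U) hφ.1 hφ.2.1)).lowerSemicontinuous
      intro x s t
      rw [← sub_mul, abs_mul, mul_comm]
      exact mul_le_mul_of_nonneg_right (hM x) (abs_nonneg _)
    · refine (ENNReal.continuous_ofReal.comp
        (continuous_integral_Lp_two (k := fun x t => huber l₁ l₂ (f x - t)) (L := l₁) ?_
          hhub)).lowerSemicontinuous
      intro x s t
      refine (abs_huber_sub_le h₁'.le h₂' _ _).trans_eq ?_
      rw [sub_sub_sub_cancel_left, abs_sub_comm]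
  have hconv : ∀ c, Convex ℝ {U | E U ≤ c} := by
    intro c U hU V hV a b ha hb hab
    have hcoe : ⇑(a • U + b • V) =ᵐ[μ] fun x => a * U x + b * V x := by
      filter_upwards [Lp.coeFn_add (a • U) (b • V), Lp.coeFn_smul a U, Lp.coeFn_smul b V]
        with x h1 h2 h3
      rw [h1, Pi.add_apply, h2, h3]
      rfl
    have hTV : totalVariation Ω (a • U + b • V : Lp ℝ 2 μ) ≤
        ENNReal.ofReal a * totalVariation Ω U + ENNReal.ofReal b * totalVariation Ω V := by
      rw [totalVariation_congr_ae hcoe]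
      exact totalVariation_convex_comb_le (hint1 U) (hint1 V) ha hb
    have hHu : ENNReal.ofReal (∫ x in Ω, huber l₁ l₂ (f x - (a • U + b • V : Lp ℝ 2 μ) x)) ≤
        ENNReal.ofReal a * ENNReal.ofReal (∫ x in Ω, huber l₁ l₂ (f x - U x)) +
        ENNReal.ofReal b * ENNReal.ofReal (∫ x in Ω, huber l₁ l₂ (f x - V x)) := by
      have hnn : ∀ W : Lp ℝ 2 μ, 0 ≤ ∫ x in Ω, huber l₁ l₂ (f x - W x) := fun W =>
        integral_nonneg fun x => huber_nonneg h₁'.le h₂' _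
      rw [← ENNReal.ofReal_mul ha, ← ENNReal.ofReal_mul hb, ← ENNReal.ofReal_add
        (mul_nonneg ha (hnn U)) (mul_nonneg hb (hnn V)), ← integral_const_mul,
        ← integral_const_mul, ← integral_add ((hhub U).const_mul a) ((hhub V).const_mul b)]
      refine ENNReal.ofReal_le_ofReal (integral_mono_ae (hhub _)
        (((hhub U).const_mul a).add ((hhub V).const_mul b)) ?_)
      filter_upwards [hcoe] with x hx
      have := (convexOn_huber h₁'.le h₂').2 (Set.mem_univ (f x - U x))
        (Set.mem_univ (f x - V x)) ha hb hab
      have harg : f x - (a * U x + b * V x) = a • (f x - U x) + b • (f x - V x) := by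
        simp only [smul_eq_mul]
        linear_combination (-f x) * hab
      rw [hx, harg]
      exact this
    calc E (a • U + b • V) ≤ _ := add_le_add hTV hHu
      _ = ENNReal.ofReal a * E U + ENNReal.ofReal b * E V := by simp only [hE]; ring
      _ ≤ ENNReal.ofReal a * c + ENNReal.ofReal b * c := by
        gcongr
        exacts [hU, hV]
      _ = c := by rw [← add_mul, ← ENNReal.ofReal_add ha hb, hab, ENNReal.ofReal_one, one_mul]
  have hB0 : 0 ≤ B := (abs_nonneg _).trans (hB 0)
  -- `R` bounds the `L²` norm of every function bounded by `B`
  set R : ℝ := (measureUnivNNReal μ : ℝ) ^ (2 : ℝ≥0∞).toReal⁻¹ * B with hR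
  have hR0 : 0 ≤ R := by positivity
  obtain ⟨U, -, hUmin⟩ := exists_forall_le_of_convex_sublevel
    (K := Metric.closedBall (0 : Lp ℝ 2 μ) R) ⟨0, by simpa using hR0⟩ Metric.isBounded_closedBall
    Metric.isClosed_closedBall (convex_closedBall _ _)
    (fun c => hlsc.isClosed_preimage c) hconv
  have hmin : ∀ w ∈ BV Ω, E U ≤ energy Ω f l₁ l₂ w := by
    intro w hw
    have hTw : MemLp (T ∘ w) 2 μ := MemLp.of_bound
      (hT.continuous.comp_aestronglyMeasurable hw.1.1) B (Eventually.of_forall fun _ => hB _)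
    have hcoe := hTw.coeFn_toLp
    have hmem : hTw.toLp ∈ Metric.closedBall (0 : Lp ℝ 2 μ) R := by
      rw [mem_closedBall_zero_iff]
      refine Lp.norm_le_of_ae_bound hB0 ?_
      filter_upwards [hcoe] with x hx
      rw [hx]
      exact hB _
    have hwi := memLp_one_iff_integrable.1 hw.1
    refine (hUmin _ hmem).trans ?_
    rw [energy_eq h₂ hfi hwi]
    refine add_le_add ?_ (ENNReal.ofReal_le_ofReal (integral_mono_ae (hhub _)
      (integrable_huber h₁'.le h₂ (hfi.sub hwi)) ?_))
    · rw [totalVariation_congr_ae hcoe]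
      exact totalVariation_comp_le hΩ hwi hT hT0 hT1 hB
    · filter_upwards [hcoe] with x hx
      rw [hx]
      exact huber_sub_comp_le h₁ h₂ hf0 hf1 hTid hTlip x
  have h0 : (0 : EuclideanSpace ℝ (Fin d) → ℝ) ∈ BV Ω :=
    ⟨MemLp.zero, by rw [totalVariation_zero]; exact ENNReal.zero_lt_top⟩
  refine ⟨U, ⟨memLp_one_iff_integrable.2 (hint1 U), ?_⟩, fun w hw => ?_⟩
  · have h2 := hmin 0 h0
    rw [energy_eq h₂ hfi (integrable_zero _ _ _), totalVariation_zero, zero_add] at h2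
    exact (le_self_add.trans h2).trans_lt ENNReal.ofReal_lt_top
  · rw [energy_eq h₂ hfi (hint1 U)]
    exact hmin w hw

end Existence

/-! ### The training data are approached but not attained -/

section Training

variable {d : ℕ} {Ω : Set (EuclideanSpace ℝ (Fin d))} {f u : EuclideanSpace ℝ (Fin d) → ℝ}
  {l₁ l₂ : ℝ≥0}

/-- The data are never reconstructed exactly: shrinking `f` to `(1 - ε) f` lowers the total
variation to first order in `ε` and raises the fidelity only to second order. -/
theorem costL2_pos [IsFiniteMeasure (volume.restrict Ω)]
    (hf : MemLp f 2 (volume.restrict Ω)) (hTV0 : totalVariation Ω f ≠ 0)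
    (hTV : totalVariation Ω f ≠ ∞) (hu : u ∈ lowerArgmin Ω f l₁ l₂) : 0 < costL2 Ω f u := by
  rw [pos_iff_ne_zero]
  intro h0
  have hum := hu.1.1.1
  have huf : u =ᵐ[volume.restrict Ω] f := by
    rw [costL2, sq_eq_zero_iff, eLpNorm_eq_zero_iff (hum.sub hf.1) two_ne_zero] at h0
    filter_upwards [h0] with x hx
    exact sub_eq_zero.1 hx
  have hfi : Integrable f (volume.restrict Ω) := hf.integrable one_le_two
  set N := (l₂ : ℝ≥0∞) / 2 * eLpNorm f 2 (volume.restrict Ω) ^ 2 with hN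
  have hNtop : N ≠ ∞ := ENNReal.mul_ne_top (ENNReal.div_ne_top ENNReal.coe_ne_top two_ne_zero)
    (ENNReal.pow_ne_top hf.2.ne)
  have key : ∀ ε : ℝ, 0 < ε → ε < 1 → totalVariation Ω f ≤
      ENNReal.ofReal (1 - ε) * totalVariation Ω f + ENNReal.ofReal (ε ^ 2) * N := by
    intro ε hε0 hε1
    have hTVw : totalVariation Ω ((1 - ε) • f) ≤ ENNReal.ofReal (1 - ε) * totalVariation Ω f := by
      have e : (1 - ε) • f = fun x => (1 - ε) * f x := rfl
      rw [e]
      have := totalVariation_convex_comb_le (Ω := Ω) hfi (integrable_zero _ _ _)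
        (a := 1 - ε) (b := 0) (by linarith) le_rfl
      simpa using this
    have hw : (1 - ε) • f ∈ BV Ω := ⟨(memLp_one_iff_integrable.2 hfi).const_smul _,
      hTVw.trans_lt (ENNReal.mul_lt_top ENNReal.ofReal_lt_top hTV.lt_top)⟩
    have hfid : icFidelity Ω l₁ l₂ ((1 - ε) • f) f ≤ ENNReal.ofReal (ε ^ 2) * N := by
      refine icFidelity_le.trans_eq ?_
      have : f - (1 - ε) • f = ε • f := by
        ext x
        simp only [Pi.sub_apply, Pi.smul_apply, smul_eq_mul]
        ring
      rw [this, eLpNorm_const_smul, mul_pow, Real.enorm_eq_ofReal hε0.le,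
        ENNReal.ofReal_pow hε0.le, hN]
      ring
    calc totalVariation Ω f = totalVariation Ω u := totalVariation_congr_ae huf.symm
      _ ≤ energy Ω f l₁ l₂ u := le_self_add
      _ ≤ energy Ω f l₁ l₂ ((1 - ε) • f) := hu.2 _ hw
      _ ≤ _ := add_le_add hTVw hfid
  obtain ⟨t, ht⟩ : ∃ t : ℝ≥0, totalVariation Ω f = t := ⟨_, (ENNReal.coe_toNNReal hTV).symm⟩
  obtain ⟨n, hn⟩ : ∃ n : ℝ≥0, N = n := ⟨_, (ENNReal.coe_toNNReal hNtop).symm⟩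
  rw [ht, ENNReal.coe_ne_zero, ← pos_iff_ne_zero] at hTV0
  have ht0 : 0 < (t : ℝ) := NNReal.coe_pos.2 hTV0
  have hn0 : 0 ≤ (n : ℝ) := n.coe_nonneg
  -- `ε` is chosen such that `ε n < t`, contradicting `t ≤ ε n` from the comparison at `ε`
  set ε : ℝ := t / (t + n + 1) with hε
  have hε0 : 0 < ε := by positivity
  have hε1 : ε < 1 := by rw [hε, div_lt_one (by positivity)]; linarith
  have h1 := key ε hε0 hε1
  rw [ht, hn, ← ENNReal.ofReal_coe_nnreal, ← ENNReal.ofReal_coe_nnreal,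
    ← ENNReal.ofReal_mul (by linarith), ← ENNReal.ofReal_mul (by positivity),
    ← ENNReal.ofReal_add (mul_nonneg (by linarith) ht0.le) (by positivity),
    ENNReal.ofReal_le_ofReal_iff (add_nonneg (mul_nonneg (by linarith) ht0.le) (by positivity))]
    at h1
  have h2 : t ≤ ε * n := by
    have : 0 ≤ ε * (ε * n - t) := by nlinarith
    linarith [nonneg_of_mul_nonneg_right this hε0]
  rw [hε, div_mul_eq_mul_div, le_div_iff₀ (by positivity)] at h2
  nlinarith

/-- Lower level minimisers are uniformly close to `f`: the truncation of a minimiser is again a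
minimiser, and the Huber function strictly increases with the modulus. -/
theorem exists_abs_sub_le_of_mem_lowerArgmin (hΩ : IsOpen Ω) [IsFiniteMeasure (volume.restrict Ω)]
    (hf : Continuous f) (hf0 : ∀ x, 0 ≤ f x) (hf1 : ∀ x, f x ≤ 1) :
    ∃ C : ℝ, 0 ≤ C ∧ ∀ l₁ l₂ : ℝ≥0, 0 < l₁ → 0 < l₂ → ∀ u ∈ lowerArgmin Ω f l₁ l₂,
      ∀ᵐ x ∂volume.restrict Ω, |f x - u x| ≤ C := by
  obtain ⟨T, B, hT, hT0, hT1, hB, hTid, hTlip⟩ := exists_smooth_truncation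
  have hB0 : 0 ≤ B := (abs_nonneg _).trans (hB 0)
  refine ⟨1 + B, by positivity, fun l₁ l₂ h₁ h₂ u hu => ?_⟩
  have h₁' : 0 < (l₁ : ℝ) := NNReal.coe_pos.2 h₁
  have h₂' : 0 < (l₂ : ℝ) := NNReal.coe_pos.2 h₂
  have hfi : Integrable f (volume.restrict Ω) :=
    integrable_of_forall_abs_le hf.aestronglyMeasurable
      fun x => by rw [abs_of_nonneg (hf0 x)]; exact hf1 x
  have hui := memLp_one_iff_integrable.1 hu.1.1
  have hTu := comp_mem_BV hΩ hu.1 hT hT0 hT1 hB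
  have hTui := memLp_one_iff_integrable.1 hTu.1
  have hi1 : Integrable (fun x => huber l₁ l₂ (f x - u x)) (volume.restrict Ω) :=
    integrable_huber h₁'.le h₂ (hfi.sub hui)
  have hi2 : Integrable (fun x => huber l₁ l₂ (f x - (T ∘ u) x)) (volume.restrict Ω) :=
    integrable_huber h₁'.le h₂ (hfi.sub hTui)
  have hle := fun x => huber_sub_comp_le (u := u) h₁ h₂ hf0 hf1 hTid hTlip x
  have hE := hu.2 _ hTu
  rw [energy_eq h₂ hfi hui, energy_eq h₂ hfi hTui] at hE
  have hE2 := hE.trans (add_le_add (totalVariation_comp_le hΩ hui hT hT0 hT1 hB) le_rfl)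
  rw [ENNReal.add_le_add_iff_left hu.1.2.ne, ENNReal.ofReal_le_ofReal_iff
    (integral_nonneg fun x => huber_nonneg h₁'.le h₂' _)] at hE2
  have hdiff : ∫ x in Ω, (huber l₁ l₂ (f x - u x) - huber l₁ l₂ (f x - (T ∘ u) x)) = 0 := by
    refine le_antisymm ?_ (integral_nonneg fun x => sub_nonneg.2 (hle x))
    rw [integral_sub hi1 hi2]
    linarith
  rw [integral_eq_zero_iff_of_nonneg (fun x => sub_nonneg.2 (hle x)) (hi1.sub hi2)] at hdiff
  filter_upwards [hdiff] with x hx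
  have h3 : |f x - u x| ≤ |f x - T (u x)| := by
    by_contra! hlt
    have := huber_lt_of_abs_lt h₁' h₂' hlt
    simp only [Function.comp_apply, Pi.zero_apply] at hx
    linarith
  refine (h3.trans (abs_sub _ _)).trans (add_le_add ?_ (hB _))
  rw [abs_of_nonneg (hf0 x)]
  exact hf1 x

/-- The calibration bounds `|Du|(Ω)` from below by `|Df|(Ω) - M ‖u - f‖₁`, so that the energy
of `f`, which has zero fidelity, controls `‖u - f‖₁`. -/
theorem integral_abs_sub_le_of_mem_lowerArgmin [IsFiniteMeasure (volume.restrict Ω)]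
    (hf : Integrable f (volume.restrict Ω))
    {φ : EuclideanSpace ℝ (Fin d) → EuclideanSpace ℝ (Fin d)} (hφ : φ ∈ testFields Ω)
    (hcal : totalVariation Ω f = ENNReal.ofReal (∫ x in Ω, f x * divergence φ x))
    (hpos : 0 ≤ ∫ x in Ω, f x * divergence φ x)
    {M : ℝ} (hM : ∀ x, |divergence φ x| ≤ M) (h₂ : 0 < l₂) (hu : u ∈ lowerArgmin Ω f l₁ l₂) :
    (l₁ - M) * ∫ x in Ω, |f x - u x| ≤
      (l₁ : ℝ) ^ 2 / (2 * l₂) * (volume.restrict Ω).real Set.univ := by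
  have h₁' : 0 ≤ (l₁ : ℝ) := l₁.coe_nonneg
  have h₂' : 0 < (l₂ : ℝ) := NNReal.coe_pos.2 h₂
  have hui := memLp_one_iff_integrable.1 hu.1.1
  have hfBV : f ∈ BV Ω := ⟨memLp_one_iff_integrable.2 hf, by
    rw [hcal]; exact ENNReal.ofReal_lt_top⟩
  have hE := hu.2 _ hfBV
  rw [energy_eq h₂ hf hui, energy_eq h₂ hf hf] at hE
  simp only [sub_self, huber_zero h₁' h₂', integral_zero, ENNReal.ofReal_zero, add_zero] at hE
  rw [hcal] at hE
  have hE2 := (add_le_add (ofReal_integral_le_totalVariation (u := u) hφ) le_rfl).trans hE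
  have hE3 := ENNReal.ofReal_add_le.trans hE2
  rw [ENNReal.ofReal_le_ofReal_iff hpos] at hE3
  have hif := integrable_mul_divergence hf hφ.1 hφ.2.1
  have hiu := integrable_mul_divergence hui hφ.1 hφ.2.1
  have hiabs : Integrable (fun x => |f x - u x|) (volume.restrict Ω) := (hf.sub hui).abs
  have hupper : (∫ x in Ω, f x * divergence φ x) - ∫ x in Ω, u x * divergence φ x ≤
      M * ∫ x in Ω, |f x - u x| := by
    rw [← integral_sub hif hiu, ← integral_const_mul]
    refine integral_mono (hif.sub hiu) (hiabs.const_mul M) fun x => ?_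
    calc f x * divergence φ x - u x * divergence φ x
        ≤ |(f x - u x) * divergence φ x| := by rw [sub_mul]; exact le_abs_self _
      _ = |divergence φ x| * |f x - u x| := by rw [abs_mul, mul_comm]
      _ ≤ M * |f x - u x| := mul_le_mul_of_nonneg_right (hM x) (abs_nonneg _)
  have hlower : l₁ * (∫ x in Ω, |f x - u x|) -
      (l₁ : ℝ) ^ 2 / (2 * l₂) * (volume.restrict Ω).real Set.univ ≤
      ∫ x in Ω, huber l₁ l₂ (f x - u x) := by
    have : ∫ x in Ω, (l₁ * |f x - u x| - (l₁ : ℝ) ^ 2 / (2 * l₂)) =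
        l₁ * (∫ x in Ω, |f x - u x|) -
          (l₁ : ℝ) ^ 2 / (2 * l₂) * (volume.restrict Ω).real Set.univ := by
      rw [integral_sub (hiabs.const_mul _) (integrable_const _), integral_const_mul,
        integral_const, smul_eq_mul, mul_comm (Measure.real _ _)]
    rw [← this]
    exact integral_mono ((hiabs.const_mul _).sub (integrable_const _))
      (integrable_huber h₁' h₂ (hf.sub hui)) fun x => mul_abs_sub_le_huber h₁' h₂' _
  linarith

theorem costL2_le_ofReal (hf : Integrable f (volume.restrict Ω))
    (hu : Integrable u (volume.restrict Ω)) {C : ℝ}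
    (hC : ∀ᵐ x ∂volume.restrict Ω, |f x - u x| ≤ C) :
    costL2 Ω f u ≤ ENNReal.ofReal (C * ∫ x in Ω, |f x - u x|) := by
  have hint : Integrable (fun x => C * |f x - u x|) (volume.restrict Ω) :=
    (hf.sub hu).abs.const_mul C
  rw [costL2, eLpNorm_two_sq_eq_lintegral, ← integral_const_mul,
    ofReal_integral_eq_lintegral_ofReal hint (by
      filter_upwards [hC] with x hx
      exact mul_nonneg ((abs_nonneg _).trans hx) (abs_nonneg _))]
  refine lintegral_mono_ae ?_
  filter_upwards [hC] with x hx
  rw [Pi.sub_apply, Real.enorm_eq_ofReal_abs, ← ENNReal.ofReal_pow (abs_nonneg _), abs_sub_comm]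
  refine ENNReal.ofReal_le_ofReal ?_
  rw [sq]
  exact mul_le_mul_of_nonneg_right hx (abs_nonneg _)

end Training

end TVIC

theorem proposition4p2 (d : ℕ) (hd : 1 ≤ d) (Ω : Set (EuclideanSpace ℝ (Fin d)))
    (hΩ_open : IsOpen Ω) (hΩ_bdd : Bornology.IsBounded Ω) (hΩ_conn : IsConnected Ω) :
    ∃ f utilde : EuclideanSpace ℝ (Fin d) → ℝ,
      MemLp f 2 (volume.restrict Ω) ∧ MemLp utilde 2 (volume.restrict Ω) ∧
      -- the bilevel problem has no solution
      (¬ ∃ (l₁ l₂ : ℝ≥0) (u : EuclideanSpace ℝ (Fin d) → ℝ),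
        TVIC.IsBilevelSolution Ω f utilde l₁ l₂ u) ∧
      -- its infimum is zero
      IsGLB (TVIC.bilevelValues Ω f utilde) 0 ∧
      -- the value zero is never attained
      (∀ (l₁ l₂ : ℝ≥0) (u : EuclideanSpace ℝ (Fin d) → ℝ),
        u ∈ TVIC.lowerArgmin Ω f l₁ l₂ → 0 < TVIC.costL2 Ω utilde u) ∧
      -- for every fixed large `l₁`, the value zero is approached as `l₂ → ∞`
      (∃ lstar : ℝ≥0, ∀ l₁ : ℝ≥0, lstar ≤ l₁ → ∀ ε : ℝ≥0∞, 0 < ε →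
        ∀ᶠ l₂ : ℝ≥0 in atTop, (TVIC.lowerArgmin Ω f l₁ l₂).Nonempty ∧
          ∀ u ∈ TVIC.lowerArgmin Ω f l₁ l₂, TVIC.costL2 Ω utilde u ≤ ε) := by
  have : IsFiniteMeasure (volume.restrict Ω) :=
    ⟨by rw [Measure.restrict_apply_univ]; exact hΩ_bdd.measure_lt_top⟩
  obtain ⟨f, φ, hf, hf0, hf1, hφ, hcal, hpos⟩ :=
    TVIC.exists_calibrated hd hΩ_open hΩ_conn.nonempty
  obtain ⟨M, hM0, hM⟩ := TVIC.exists_abs_divergence_le hφ.1 hφ.2.1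
  obtain ⟨C, hC0, hC⟩ := TVIC.exists_abs_sub_le_of_mem_lowerArgmin hΩ_open hf hf0 hf1
  have hf2 : MemLp f 2 (volume.restrict Ω) := MemLp.of_bound hf.aestronglyMeasurable 1
    (Eventually.of_forall fun x => by rw [Real.norm_of_nonneg (hf0 x)]; exact hf1 x)
  have hfi : Integrable f (volume.restrict Ω) := hf2.integrable one_le_two
  have hpositive : ∀ (l₁ l₂ : ℝ≥0) (u : EuclideanSpace ℝ (Fin d) → ℝ),
      u ∈ TVIC.lowerArgmin Ω f l₁ l₂ → 0 < TVIC.costL2 Ω f u := fun l₁ l₂ u hu =>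
    TVIC.costL2_pos hf2 (by rw [hcal]; exact (ENNReal.ofReal_pos.2 hpos).ne')
      (by rw [hcal]; exact ENNReal.ofReal_ne_top) hu
  have happroach : ∀ l₁ : ℝ≥0, ⟨M + 1, by positivity⟩ ≤ l₁ → ∀ ε : ℝ≥0∞, 0 < ε →
      ∀ᶠ l₂ : ℝ≥0 in atTop, (TVIC.lowerArgmin Ω f l₁ l₂).Nonempty ∧
        ∀ u ∈ TVIC.lowerArgmin Ω f l₁ l₂, TVIC.costL2 Ω f u ≤ ε := by
    intro l₁ hl₁ ε hε
    have hl₁' : M + 1 ≤ (l₁ : ℝ) := hl₁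
    have h₁ : 0 < l₁ := NNReal.coe_pos.1 (by linarith)
    have hlim : Tendsto (fun l₂ : ℝ≥0 => ENNReal.ofReal
        (C * ((l₁ : ℝ) ^ 2 / (2 * l₂) * (volume.restrict Ω).real Set.univ))) atTop (𝓝 0) := by
      have h1 : Tendsto (fun l₂ : ℝ≥0 => (l₁ : ℝ) ^ 2 / (2 * (l₂ : ℝ))) atTop (𝓝 0) :=
        tendsto_const_nhds.div_atTop
          ((NNReal.tendsto_coe_atTop.2 tendsto_id).const_mul_atTop two_pos)
      have h2 := ENNReal.tendsto_ofReal
        ((h1.mul_const ((volume.restrict Ω).real Set.univ)).const_mul C)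
      simpa using h2
    filter_upwards [hlim.eventually_le_const hε, eventually_gt_atTop 0] with l₂ hl₂ h₂
    refine ⟨TVIC.lowerArgmin_nonempty hΩ_open hf hf0 hf1 h₁ h₂, fun u hu => ?_⟩
    refine (TVIC.costL2_le_ofReal hfi (memLp_one_iff_integrable.1 hu.1.1)
      (hC l₁ l₂ h₁ h₂ u hu)).trans (le_trans (ENNReal.ofReal_le_ofReal ?_) hl₂)
    refine mul_le_mul_of_nonneg_left ?_ hC0
    refine le_trans ?_
      (TVIC.integral_abs_sub_le_of_mem_lowerArgmin hfi hφ hcal hpos.le hM h₂ hu)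
    exact le_mul_of_one_le_left (integral_nonneg fun _ => abs_nonneg _) (by linarith)
  have hsmall : ∀ ε : ℝ≥0∞, 0 < ε → ∃ (l₁ l₂ : ℝ≥0) (u : EuclideanSpace ℝ (Fin d) → ℝ),
      u ∈ TVIC.lowerArgmin Ω f l₁ l₂ ∧ TVIC.costL2 Ω f u ≤ ε := by
    intro ε hε
    obtain ⟨l₂, ⟨u, hu⟩, h⟩ := (happroach _ le_rfl ε hε).exists
    exact ⟨_, l₂, u, hu, h u hu⟩
  refine ⟨f, f, hf2, hf2, ?_, ⟨fun _ _ => zero_le, fun b hb => ?_⟩, hpositive,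
    _, happroach⟩
  · rintro ⟨l₁, l₂, u, hu, hmin⟩
    have hp := hpositive l₁ l₂ u hu
    obtain ⟨ε, hε0, hε⟩ := exists_between hp
    obtain ⟨m₁, m₂, w, hw, hle⟩ := hsmall ε hε0
    exact absurd ((hmin m₁ m₂ w hw).trans hle) (not_le.2 hε)
  · refine le_of_forall_pos_le_add fun ε hε => ?_
    obtain ⟨l₁, l₂, u, hu, hle⟩ := hsmall ε hε
    rw [zero_add]
    exact (hb ⟨l₁, l₂, u, hu, rfl⟩).trans hle
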